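/- Let $E$ be a real Banach lattice. Suppose that (i) $E$ is disjointly homogeneous (DH): for every two sequences $(x_n)$, $(y_n)$ of norm-one, pairwise disjoint elements of $E$ there are a constant $C>0$ and a common subsequence $(n_k)$ such that $$C^{-1}\Big\|\sum_k a_k y_{n_k}\Big\|\le\Big\|\sum_k a_k x_{n_k}\Big\|\le C\Big\|\sum_k a_k y_{n_k}\Big\|$$ for all finitely supported real sequences $(a_k)$; (ii) $E$ has finite cotype: there are $2\le q<\infty$ and $M$ such that $\big(\sum_{i=1}^n\|x_i\|^q\big)^{1/q}\le M\cdot 2^{-n}\sum_{\varepsilon\in\{-1,1\}^n}\big\|\sum_{i=1}^n\varepsilon_i x_i\big\|$ for all $n$ and all $x_1,\dots,x_n\in E$; (iii) $E$ has a (countable) unconditional Schauder basis, which need not be related to the order of $E$. Then for every strictly singular bounded linear operator $T:E\to E$ (that is, $T$ is not bounded below on any infinite-dimensional subspace of $E$), the square $T^2$ is a compact operator. -/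

import Mathlib

/-- The sequences `x` and `y` are `C`-equivalent:
`C⁻¹ ‖∑ aₙ yₙ‖ ≤ ‖∑ aₙ xₙ‖ ≤ C ‖∑ aₙ yₙ‖` for all finitely supported families of scalars `(aₙ)`
(for basic sequences in a Banach space this is the same as asking it for all convergent sums). -/
def SeqEquivalentWith {X Y : Type*} [NormedAddCommGroup X] [NormedSpace ℝ X]
    [NormedAddCommGroup Y] [NormedSpace ℝ Y] (C : ℝ) (x : ℕ → X) (y : ℕ → Y) : Prop :=
  ∀ (s : Finset ℕ) (a : ℕ → ℝ),
    C⁻¹ * ‖∑ n ∈ s, a n • y n‖ ≤ ‖∑ n ∈ s, a n • x n‖ ∧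
      ‖∑ n ∈ s, a n • x n‖ ≤ C * ‖∑ n ∈ s, a n • y n‖

/-- A normalized sequence of pairwise disjoint elements of a normed lattice. -/
def IsNormalizedDisjointSeq {E : Type*} [NormedAddCommGroup E] [Lattice E] (x : ℕ → E) : Prop :=
  (∀ n, ‖x n‖ = 1) ∧ ∀ m n, m ≠ n → |x m| ⊓ |x n| = 0

/-- Disjoint homogeneity: for every two normalized disjoint sequences `x`, `y` there are `C > 0` and
one common subsequence `(nₖ)` along which they are `C`-equivalent. -/
def IsDisjointlyHomogeneous (E : Type*) [NormedAddCommGroup E] [NormedSpace ℝ E] [Lattice E] :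
    Prop :=
  ∀ x y : ℕ → E, IsNormalizedDisjointSeq x → IsNormalizedDisjointSeq y →
    ∃ C : ℝ, 0 < C ∧ ∃ φ : ℕ → ℕ, StrictMono φ ∧ SeqEquivalentWith C (x ∘ φ) (y ∘ φ)

/-- Cotype `q`: there is `M` with `(∑ ‖xᵢ‖ ^ q) ^ (1 / q) ≤ M * 𝔼 ‖∑ εᵢ xᵢ‖` for all finite
families, the expectation being over independent uniform signs (average over all `2 ^ n` signs). -/
def HasCotype (X : Type*) [NormedAddCommGroup X] (q : ℝ) : Prop :=
  ∃ M : ℝ, ∀ (n : ℕ) (x : Fin n → X),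
    (∑ i, ‖x i‖ ^ q) ^ (1 / q) ≤ M * ((∑ ε : Fin n → ℤˣ, ‖∑ i, ε i • x i‖) / 2 ^ n)

/-- Finite cotype: cotype `q` for some `2 ≤ q < ∞`. -/
def HasFiniteCotype (X : Type*) [NormedAddCommGroup X] : Prop :=
  ∃ q : ℝ, 2 ≤ q ∧ HasCotype X q

/-- A bounded operator is strictly singular if it is not bounded below (that is, not an isomorphism
onto its image) on any infinite-dimensional subspace. -/
def IsStrictlySingular {X Y : Type*} [NormedAddCommGroup X] [NormedSpace ℝ X]
    [NormedAddCommGroup Y] [NormedSpace ℝ Y] (T : X →L[ℝ] Y) : Prop :=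
  ∀ V : Submodule ℝ X, ¬ FiniteDimensional ℝ V →
    ¬ ∃ c : ℝ, 0 < c ∧ ∀ v ∈ V, c * ‖v‖ ≤ ‖T v‖

/-! ### Order identities in lattice-ordered groups: truncation, Riesz decomposition, disjoint sums.
-/

section LatticeGroup

variable {G : Type*} [AddCommGroup G] [Lattice G] [IsOrderedAddMonoid G]

/-! The basis provides a quasi-interior point `u`. A sequence that is both un-null (`|xₙ| ⊓ u → 0`
in norm) and almost order bounded (its parts above `M • u` are eventually small) tends to zero in
norm, by `IsUnNull.tendsto_zero`. The proof produces these two properties from strict singularity.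

Order bounded input (`IsStrictlySingular.isUnNull_of_abs_le`): let `e` be order bounded, with `e`
and `S ∘ e` coordinatewise null. If `S ∘ e` were not un-null, finite cotype would give one positive
functional bounded below on a subsequence of `|S eₙ|`, and Khinchine's inequality a lower `ℓ²`
estimate for signed averages of `S ∘ e`. Finite cotype also gives an upper `ℓ²` estimate for signed
averages of `e`. The basis yields unconditional subsequences, so the averages can be dropped, and
`S` is bounded below on an infinite-dimensional span.

Un-null input (`IsStrictlySingular.exists_isAlmostOrderBounded_subseq`): a bounded un-null sequence
is, along a subsequence, a small perturbation of a disjoint sequence `d`. If `S ∘ d` were not almost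
order bounded, its parts above growing multiples of `u` would contain disjoint `Dₖ ≤ |S dₖ|`,
bounded below in norm. Unconditionality lets `S ∘ d` dominate `D`, and disjoint homogeneity lets `D`
dominate `d`; again `S` is bounded below on a span.

For compactness of `T ^ 2`, take a bounded sequence whose coordinates, together with those of its
truncations and of their images, converge. Differences of its terms split into an order bounded part
`e` and an un-null part `r`. Here `T e` is un-null, so `T (T e)` is almost order bounded along
subsequences, and it is un-null because `T ∘ T` is strictly singular too. For `r`, `T r` is almost
order bounded, so up to a small error `T` acts on an order bounded sequence, and `T (T r)` converges
along a subsequence. A diagonal choice joins the two parts. -/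

theorem sum_abs_le_of_forall_units_smul {ι : Type*} (s : Finset ι) (y : ι → G) (z : G)
    (h : ∀ η : ι → ℤˣ, ∑ i ∈ s, η i • y i ≤ z) : ∑ i ∈ s, |y i| ≤ z := by
  classical
  induction s using Finset.induction_on generalizing z with
  | empty => simpa using h 1
  | insert a s ha ih =>
    -- The sum of moduli is the supremum of the signed sums; the term `|y a|` is moved into the
    -- bound, and both signs of `y a` are tested.
    rw [Finset.sum_insert ha, ← le_sub_iff_add_le']
    refine ih _ fun η ↦ ?_
    rw [le_sub_comm, abs_le']
    have key : ∀ e : ℤˣ, e • y a + ∑ i ∈ s, η i • y i ≤ z := fun e ↦ by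
      have := h (Function.update η a e)
      rw [Finset.sum_insert ha, Function.update_self] at this
      convert this using 2
      refine Finset.sum_congr rfl fun i hi ↦ ?_
      rw [Function.update_of_ne (by rintro rfl; exact ha hi)]
    constructor
    · simpa [le_sub_iff_add_le] using key 1
    · have := key (-1)
      rw [le_sub_iff_add_le]
      simpa using this

theorem inf_add_posPart_sub (a b : G) : a ⊓ b + (a - b)⁺ = a := by
  rw [inf_eq_sub_posPart_sub, sub_add_cancel]

theorem add_inf_le_inf_add_inf {a b c : G} (ha : 0 ≤ a) (hb : 0 ≤ b) (hc : 0 ≤ c) :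
    (a + b) ⊓ c ≤ a ⊓ c + b ⊓ c := by
  rw [add_inf, inf_add, inf_add]
  refine le_inf (le_inf inf_le_left ?_) (le_inf ?_ ?_)
  · exact inf_le_right.trans (le_add_of_nonneg_right hb)
  · exact inf_le_right.trans (le_add_of_nonneg_left ha)
  · exact inf_le_right.trans (le_add_of_nonneg_left hc)

theorem posPart_add_le (a b : G) : (a + b)⁺ ≤ a⁺ + b⁺ := by
  rw [posPart_def]
  exact sup_le (add_le_add (le_posPart a) (le_posPart b))
    (add_nonneg (posPart_nonneg a) (posPart_nonneg b))

/-- Truncation of `x` to the order interval `[-w, w]`. -/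
def latticeTrunc (w x : G) : G := (x ⊓ w) ⊔ (-w)

theorem abs_latticeTrunc_le {w : G} (hw : 0 ≤ w) (x : G) : |latticeTrunc w x| ≤ w := by
  rw [abs_le', latticeTrunc]
  refine ⟨sup_le inf_le_right ((neg_nonpos.2 hw).trans hw), ?_⟩
  rw [neg_le]
  exact le_sup_right

theorem abs_sub_latticeTrunc_le (w x : G) : |x - latticeTrunc w x| ≤ (|x| - w)⁺ := by
  rw [abs_le', latticeTrunc]
  constructor
  · calc x - (x ⊓ w) ⊔ (-w) ≤ x - x ⊓ w := sub_le_sub_left le_sup_left _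
      _ = (x - w)⁺ := by rw [sub_eq_iff_eq_add', inf_add_posPart_sub]
      _ ≤ (|x| - w)⁺ := posPart_mono (sub_le_sub_right (le_abs_self x) w)
  · rw [neg_sub, sup_sub]
    refine sup_le ?_ ?_
    · exact (sub_nonpos.2 inf_le_left).trans (posPart_nonneg _)
    · refine le_trans ?_ (le_posPart _)
      rw [neg_sub_left, neg_add', ]
      exact sub_le_sub_right (neg_le_abs x) w

/-- Greedy choice: the first summand takes `v ⊓ w a`, and what is left of `v`, namely `(v - w a)⁺`,
fits under the remaining summands. -/
theorem riesz_decomposition {κ : Type*} (s : Finset κ) (w : κ → G) (hw : ∀ k ∈ s, 0 ≤ w k) (v : G)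
    (hv : 0 ≤ v) (hvw : v ≤ ∑ k ∈ s, w k) :
    ∃ v' : κ → G, (∀ k ∈ s, 0 ≤ v' k ∧ v' k ≤ w k) ∧ ∑ k ∈ s, v' k = v := by
  classical
  induction s using Finset.induction_on generalizing v with
  | empty => exact ⟨0, by simp, by simpa using hv.antisymm (by simpa using hvw)⟩
  | insert a s ha ih =>
    rw [Finset.sum_insert ha] at hvw
    obtain ⟨v', h1, h2⟩ := ih (fun k hk ↦ hw k (Finset.mem_insert_of_mem hk)) (v - w a)⁺
      (posPart_nonneg _) (by
        rw [posPart_def]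
        exact sup_le (sub_le_iff_le_add'.2 hvw)
          (Finset.sum_nonneg fun k hk ↦ hw k (Finset.mem_insert_of_mem hk)))
    refine ⟨Function.update v' a (v ⊓ w a), fun k hk ↦ ?_, ?_⟩
    · by_cases hka : k = a
      · subst hka
        simpa using ⟨hv, hw k hk⟩
      · rw [Function.update_of_ne hka]
        exact h1 k (Finset.mem_of_mem_insert_of_ne hk hka)
    · rw [Finset.sum_insert ha, Function.update_self,
        Finset.sum_congr rfl (g := v') fun i hi ↦ by
          rw [Function.update_of_ne (by rintro rfl; exact ha hi)], h2, inf_add_posPart_sub]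

/-- Finitely many elements of `[0, u]` are subsums of one finite partition of `u`. -/
theorem exists_common_partition {u : G} (hu : 0 ≤ u) {ι : Type*} (s : Finset ι) (v : ι → G)
    (hv : ∀ i ∈ s, 0 ≤ v i ∧ v i ≤ u) :
    ∃ (κ : Type) (_ : Fintype κ) (w : κ → G) (A : ι → Finset κ), (∀ k, 0 ≤ w k) ∧
      ∑ k, w k = u ∧ ∀ i ∈ s, v i = ∑ k ∈ A i, w k := by
  classical
  induction s using Finset.induction_on with
  | empty => exact ⟨Unit, inferInstance, fun _ ↦ u, fun _ ↦ ∅, by simpa using hu, by simp, by simp⟩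
  | insert a s ha ih =>
    obtain ⟨κ, _, w, A, hw, hwu, hA⟩ := ih fun i hi ↦ hv i (Finset.mem_insert_of_mem hi)
    obtain ⟨hva, hvau⟩ := hv a (Finset.mem_insert_self _ _)
    obtain ⟨v', h1, h2⟩ := riesz_decomposition Finset.univ w (fun k _ ↦ hw k) (v a) hva
      (by rwa [hwu])
    -- Each old piece `w k` is cut into `v' k` and its complement. Old index sets keep both halves;
    -- the new element is the sum of the `true` halves.
    refine ⟨κ × Bool, inferInstance, fun p ↦ if p.2 then v' p.1 else w p.1 - v' p.1,
      fun i ↦ if i = a then Finset.univ ×ˢ {true} else A i ×ˢ Finset.univ, fun p ↦ ?_, ?_, ?_⟩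
    · rcases p with ⟨k, b⟩
      cases b
      · simpa using (h1 k (Finset.mem_univ _)).2
      · simpa using (h1 k (Finset.mem_univ _)).1
    · rw [Fintype.sum_prod_type]
      simpa using hwu
    · intro i hi
      by_cases hia : i = a
      · subst hia
        simp [h2]
      · simp only [hia, if_false]
        rw [Finset.sum_product, hA i (Finset.mem_of_mem_insert_of_ne hi hia)]
        simp

theorem lattice_abs_sum_le {ι : Type*} (s : Finset ι) (x : ι → G) :
    |∑ i ∈ s, x i| ≤ ∑ i ∈ s, |x i| :=
  Finset.le_sum_of_subadditive _ abs_zero.le abs_add_le _ _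

theorem abs_add_of_abs_inf_abs_eq_zero {x y : G} (h : |x| ⊓ |y| = 0) : |x + y| = |x| + |y| := by
  refine le_antisymm (abs_add_le x y) ?_
  have key : ∀ a b : G, |a| ⊓ |b| = 0 → |a| ≤ |a + b| := fun a b hab ↦ by
    have h1 : |a| ≤ |a + b| + |b| := by
      have := abs_add_le (a + b) (-b)
      rwa [abs_neg, add_neg_cancel_right] at this
    calc |a| = (|a + b| + |b|) ⊓ |a| := (inf_eq_right.2 h1).symm
      _ ≤ |a + b| ⊓ |a| + |b| ⊓ |a| :=
        add_inf_le_inf_add_inf (abs_nonneg _) (abs_nonneg _) (abs_nonneg _)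
      _ ≤ |a + b| := by rw [inf_comm |b|, hab, add_zero]; exact inf_le_left
  rw [← inf_add_sup |x| |y|, h, zero_add]
  exact sup_le (key x y h) (by rw [add_comm]; exact key y x (by rwa [inf_comm]))

theorem inf_sum_eq_zero {ι : Type*} (s : Finset ι) (a : G) (x : ι → G) (ha : 0 ≤ a)
    (hx : ∀ i ∈ s, 0 ≤ x i) (h : ∀ i ∈ s, a ⊓ x i = 0) : a ⊓ ∑ i ∈ s, x i = 0 := by
  classical
  induction s using Finset.induction_on with
  | empty => simpa using ha
  | insert b s hb ih =>
    have hs : 0 ≤ ∑ i ∈ s, x i := Finset.sum_nonneg fun i hi ↦ hx i (Finset.mem_insert_of_mem hi)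
    have hb0 := hx b (Finset.mem_insert_self _ _)
    rw [Finset.sum_insert hb]
    refine le_antisymm ?_ (le_inf ha (add_nonneg hb0 hs))
    rw [inf_comm]
    refine (add_inf_le_inf_add_inf hb0 hs ha).trans ?_
    rw [inf_comm, h b (Finset.mem_insert_self _ _), inf_comm,
      ih (fun i hi ↦ hx i (Finset.mem_insert_of_mem hi))
        (fun i hi ↦ h i (Finset.mem_insert_of_mem hi)), add_zero]

theorem abs_sum_of_pairwise_disjoint {ι : Type*} (s : Finset ι) (x : ι → G)
    (h : ∀ i ∈ s, ∀ j ∈ s, i ≠ j → |x i| ⊓ |x j| = 0) : |∑ i ∈ s, x i| = ∑ i ∈ s, |x i| := by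
  classical
  induction s using Finset.induction_on with
  | empty => simp
  | insert b s hb ih =>
    have ih' := ih fun i hi j hj ↦ h i (Finset.mem_insert_of_mem hi) j (Finset.mem_insert_of_mem hj)
    rw [Finset.sum_insert hb, Finset.sum_insert hb, abs_add_of_abs_inf_abs_eq_zero, ih']
    rw [ih']
    exact inf_sum_eq_zero _ _ _ (abs_nonneg _) (fun _ _ ↦ abs_nonneg _) fun i hi ↦
      h b (Finset.mem_insert_self _ _) i (Finset.mem_insert_of_mem hi)
        (by rintro rfl; exact hb hi)

theorem sum_le_of_pairwise_disjoint {ι : Type*} (s : Finset ι) (x : ι → G) {z : G} (hz : 0 ≤ z)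
    (hx : ∀ i ∈ s, 0 ≤ x i) (h : ∀ i ∈ s, ∀ j ∈ s, i ≠ j → x i ⊓ x j = 0)
    (hxz : ∀ i ∈ s, x i ≤ z) : ∑ i ∈ s, x i ≤ z := by
  classical
  induction s using Finset.induction_on with
  | empty => simpa
  | insert b s hb ih =>
    have ih' := ih (fun i hi ↦ hx i (Finset.mem_insert_of_mem hi))
      (fun i hi j hj ↦ h i (Finset.mem_insert_of_mem hi) j (Finset.mem_insert_of_mem hj))
      (fun i hi ↦ hxz i (Finset.mem_insert_of_mem hi))
    have h0 := inf_sum_eq_zero s (x b) x (hx b (Finset.mem_insert_self _ _))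
      (fun i hi ↦ hx i (Finset.mem_insert_of_mem hi)) fun i hi ↦
      h b (Finset.mem_insert_self _ _) i (Finset.mem_insert_of_mem hi)
        (by rintro rfl; exact hb hi)
    rw [Finset.sum_insert hb, ← inf_add_sup, h0, zero_add]
    exact sup_le (hxz b (Finset.mem_insert_self _ _)) ih'

end LatticeGroup

/-! ### Scalars and disjointness in vector lattices. -/

section LatticeModule

variable {G : Type*} [AddCommGroup G] [Module ℝ G] [Lattice G] [IsOrderedAddMonoid G]
  [IsOrderedModule ℝ G]

omit [IsOrderedAddMonoid G] in
theorem smul_sup_of_nonneg {t : ℝ} (ht : 0 ≤ t) (a b : G) : t • (a ⊔ b) = t • a ⊔ t • b := by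
  rcases ht.eq_or_lt with rfl | ht
  · simp
  · exact (OrderIso.smulRight ht).map_sup a b

omit [IsOrderedAddMonoid G] in
theorem smul_inf_of_nonneg {t : ℝ} (ht : 0 ≤ t) (a b : G) : t • (a ⊓ b) = t • a ⊓ t • b := by
  rcases ht.eq_or_lt with rfl | ht
  · simp
  · exact (OrderIso.smulRight ht).map_inf a b

omit [IsOrderedAddMonoid G] in
theorem lattice_abs_smul (t : ℝ) (x : G) : |t • x| = |t| • |x| := by
  have key : ∀ s : ℝ, 0 ≤ s → |s • x| = s • |x| := fun s hs ↦ by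
    rw [abs, abs, smul_sup_of_nonneg hs, smul_neg]
  rcases le_total 0 t with ht | ht
  · rw [key t ht, abs_of_nonneg ht]
  · rw [abs_of_nonpos ht, ← key (-t) (neg_nonneg.2 ht), neg_smul, abs_neg]

theorem smul_inf_smul_eq_zero {a b : G} (ha : 0 ≤ a) (hb : 0 ≤ b) (h : a ⊓ b = 0) {s t : ℝ}
    (hs : 0 ≤ s) (ht : 0 ≤ t) : (s • a) ⊓ (t • b) = 0 := by
  refine le_antisymm ?_ (le_inf (smul_nonneg hs ha) (smul_nonneg ht hb))
  calc (s • a) ⊓ (t • b) ≤ (max s t • a) ⊓ (max s t • b) :=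
        inf_le_inf (smul_le_smul_of_nonneg_right (le_max_left _ _) ha)
          (smul_le_smul_of_nonneg_right (le_max_right _ _) hb)
    _ = 0 := by rw [← smul_inf_of_nonneg (hs.trans (le_max_left _ _)), h, smul_zero]

theorem abs_smul_inf_abs_smul_eq_zero {x y : G} (h : |x| ⊓ |y| = 0) (s t : ℝ) :
    |s • x| ⊓ |t • y| = 0 := by
  rw [lattice_abs_smul, lattice_abs_smul]
  exact smul_inf_smul_eq_zero (abs_nonneg _) (abs_nonneg _) h (abs_nonneg _) (abs_nonneg _)

/-- A Chebyshev inequality: the part of `a` above `M • u` is disjoint from `(M • u - a)⁺`, and `M •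
u ≤ (M • u - a)⁺ + a`, so its meet with `M • u` only sees `a`. In norm, the excess over `M • u`
meets `u` in size `O(1 / M)`. -/
theorem smul_posPart_sub_inf_le {a u : G} (ha : 0 ≤ a) {M : ℝ} (hM : 0 ≤ M) :
    M • ((a - M • u)⁺ ⊓ u) ≤ a := by
  have h0 : (a - M • u)⁺ ⊓ (M • u - a)⁺ = 0 := by
    rw [← neg_sub a, posPart_neg]
    exact posPart_inf_negPart_eq_zero _
  have h1 : (M • (a - M • u)⁺) ⊓ (M • u - a)⁺ = 0 := by
    have := smul_inf_smul_eq_zero (posPart_nonneg _) (posPart_nonneg _) h0 hM zero_le_one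
    rwa [one_smul] at this
  rw [smul_inf_of_nonneg hM]
  have hx : 0 ≤ M • (a - M • u)⁺ := smul_nonneg hM (posPart_nonneg _)
  calc (M • (a - M • u)⁺) ⊓ (M • u) ≤ ((M • u - a)⁺ + a) ⊓ (M • (a - M • u)⁺) := by
        rw [inf_comm]
        exact inf_le_inf_right _ (sub_le_iff_le_add.1 (le_posPart _))
    _ ≤ (M • u - a)⁺ ⊓ (M • (a - M • u)⁺) + a ⊓ (M • (a - M • u)⁺) :=
        add_inf_le_inf_add_inf (posPart_nonneg _) ha hx
    _ ≤ a := by rw [inf_comm, h1, zero_add]; exact inf_le_left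

end LatticeModule

/-! ### Monotonicity of the norm. -/

section NormedLattice

variable {E : Type*} [NormedAddCommGroup E] [Lattice E] [IsOrderedAddMonoid E] [HasSolidNorm E]

omit [IsOrderedAddMonoid E] in
theorem norm_le_norm_of_abs_le {x y : E} (h : |x| ≤ y) : ‖x‖ ≤ ‖y‖ :=
  norm_le_norm_of_abs_le_abs (h.trans (le_abs_self y))

theorem norm_le_norm_of_nonneg_of_le {x y : E} (hx : 0 ≤ x) (h : x ≤ y) : ‖x‖ ≤ ‖y‖ :=
  norm_le_norm_of_abs_le (by rwa [abs_of_nonneg hx])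

end NormedLattice

/-! ### Averages over signs and Riesz products. -/

section Signs

theorem card_signs (n : ℕ) : Fintype.card (Fin n → ℤˣ) = 2 ^ n := by simp

/-- The average of `F` over all `2 ^ n` choices of signs. -/
noncomputable def signAvg {n : ℕ} (F : (Fin n → ℤˣ) → ℝ) : ℝ := (∑ ε, F ε) / 2 ^ n

theorem signAvg_mono {n : ℕ} {F F' : (Fin n → ℤˣ) → ℝ} (h : ∀ ε, F ε ≤ F' ε) :
    signAvg F ≤ signAvg F' :=
  div_le_div_of_nonneg_right (Finset.sum_le_sum fun ε _ ↦ h ε) (by positivity)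

theorem signAvg_const {n : ℕ} (c : ℝ) : signAvg (fun _ : Fin n → ℤˣ ↦ c) = c := by
  rw [signAvg, Finset.sum_const, Finset.card_univ, card_signs, nsmul_eq_mul]
  push_cast
  field_simp

theorem signAvg_le_of_le {n : ℕ} {F : (Fin n → ℤˣ) → ℝ} {c : ℝ} (h : ∀ ε, F ε ≤ c) :
    signAvg F ≤ c := (signAvg_mono h).trans (signAvg_const c).le

theorem le_signAvg_of_le {n : ℕ} {F : (Fin n → ℤˣ) → ℝ} {c : ℝ} (h : ∀ ε, c ≤ F ε) :
    c ≤ signAvg F := (signAvg_const c).ge.trans (signAvg_mono h)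

theorem signAvg_const_mul {n : ℕ} (c : ℝ) (F : (Fin n → ℤˣ) → ℝ) :
    signAvg (fun ε ↦ c * F ε) = c * signAvg F := by
  rw [signAvg, signAvg, ← Finset.mul_sum, mul_div_assoc]

theorem signAvg_add {n : ℕ} (F F' : (Fin n → ℤˣ) → ℝ) :
    signAvg (fun ε ↦ F ε + F' ε) = signAvg F + signAvg F' := by
  rw [signAvg, signAvg, signAvg, Finset.sum_add_distrib, add_div]

theorem signAvg_sum {n : ℕ} {ι : Type*} (s : Finset ι) (F : ι → (Fin n → ℤˣ) → ℝ) :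
    signAvg (fun ε ↦ ∑ i ∈ s, F i ε) = ∑ i ∈ s, signAvg (F i) := by
  simp only [signAvg]
  rw [Finset.sum_comm, Finset.sum_div]

theorem units_int_smul_eq {V : Type*} [AddCommGroup V] [Module ℝ V] (e : ℤˣ) (x : V) :
    e • x = ((e : ℤ) : ℝ) • x := by
  rw [Units.smul_def, Int.cast_smul_eq_zsmul]

theorem sum_prod_signs {R : Type*} [CommRing R] {n : ℕ} (f : Fin n → ℤˣ → R) :
    ∑ ε : Fin n → ℤˣ, ∏ j, f j (ε j) = ∏ j, (f j 1 + f j (-1)) := by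
  have := Finset.prod_univ_sum (fun _ : Fin n ↦ (Finset.univ : Finset ℤˣ)) f
  rw [Fintype.piFinset_univ] at this
  rw [← this]
  refine Finset.prod_congr rfl fun j _ ↦ ?_
  rw [show (Finset.univ : Finset ℤˣ) = {1, -1} from rfl, Finset.sum_pair (by decide)]

/-- The imaginary part of the Riesz product `∏ (1 + i bⱼ εⱼ)`. -/
noncomputable def rieszProductIm {n : ℕ} (b : Fin n → ℝ) (ε : Fin n → ℤˣ) : ℝ :=
  (∏ j, (1 + (b j : ℂ) * ((ε j : ℤ) : ℂ) * Complex.I)).im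

theorem abs_rieszProductIm_le {n : ℕ} (b : Fin n → ℝ) (ε : Fin n → ℤˣ) :
    |rieszProductIm b ε| ≤ ∏ j, √(1 + b j ^ 2) := by
  refine (Complex.abs_im_le_norm _).trans ?_
  rw [norm_prod]
  refine Finset.prod_le_prod (fun _ _ ↦ norm_nonneg _) fun j _ ↦ ?_
  have h : (1 + (b j : ℂ) * ((ε j : ℤ) : ℂ) * Complex.I) =
      ((1 : ℝ) : ℂ) + ((b j * (ε j : ℤ) : ℝ) : ℂ) * Complex.I := by push_cast; ring
  rw [h, Complex.norm_add_mul_I, one_pow, mul_pow]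
  rcases Int.units_eq_one_or (ε j) with h | h <;> simp [h]

/-- Independence of the signs: factors with `j ≠ i` average to `1`, while the factor `i`, multiplied
by `εᵢ`, averages to `bᵢ` times the imaginary unit. The Riesz product thus has prescribed
first-order coefficients and a controlled sup norm. -/
theorem sum_sign_mul_rieszProductIm {n : ℕ} (b : Fin n → ℝ) (i : Fin n) :
    ∑ ε : Fin n → ℤˣ, ((ε i : ℤ) : ℝ) * rieszProductIm b ε = 2 ^ n * b i := by
  have h1 : ∀ ε : Fin n → ℤˣ, ((ε i : ℤ) : ℝ) * rieszProductIm b ε =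
      (∏ j, ((if j = i then ((ε j : ℤ) : ℂ) else 1) *
        (1 + (b j : ℂ) * ((ε j : ℤ) : ℂ) * Complex.I))).im := fun ε ↦ by
    rw [Finset.prod_mul_distrib, Finset.prod_ite_eq' Finset.univ i, if_pos (Finset.mem_univ _),
      rieszProductIm, show (((ε i : ℤ) : ℂ)) = (((ε i : ℤ) : ℝ) : ℂ) by push_cast; rfl,
      Complex.im_ofReal_mul]
  rw [Finset.sum_congr rfl fun ε _ ↦ h1 ε, ← Complex.im_sum,
    sum_prod_signs fun j e ↦ (if j = i then ((e : ℤ) : ℂ) else 1) *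
        (1 + (b j : ℂ) * ((e : ℤ) : ℂ) * Complex.I)]
  have h2 : ∀ j : Fin n, (if j = i then (((1 : ℤˣ) : ℤ) : ℂ) else 1) *
        (1 + (b j : ℂ) * (((1 : ℤˣ) : ℤ) : ℂ) * Complex.I) +
      (if j = i then (((-1 : ℤˣ) : ℤ) : ℂ) else 1) *
        (1 + (b j : ℂ) * (((-1 : ℤˣ) : ℤ) : ℂ) * Complex.I) =
      2 * (if j = i then (b j : ℂ) * Complex.I else 1) := fun j ↦ by
    split_ifs <;> push_cast [Units.val_neg, Units.val_one] <;> ring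
  rw [Finset.prod_congr rfl fun j _ ↦ h2 j, Finset.prod_mul_distrib,
    Finset.prod_ite_eq' Finset.univ i, if_pos (Finset.mem_univ _), Finset.prod_const,
    Finset.card_univ, Fintype.card_fin]
  have h3 : (2 : ℂ) ^ n * ((b i : ℂ) * Complex.I) = ((2 ^ n * b i : ℝ) : ℂ) * Complex.I := by
    push_cast; ring
  rw [h3, Complex.im_ofReal_mul, Complex.I_im, mul_one]

theorem sum_sign_mul_rieszProductIm_mul {n : ℕ} (b : Fin n → ℝ) (η : Fin n → ℤˣ) (i : Fin n) :
    ∑ ε : Fin n → ℤˣ, ((ε i : ℤ) : ℝ) * rieszProductIm b (η * ε) = 2 ^ n * ((η i : ℤ) * b i) := by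
  rw [← Equiv.sum_comp (Equiv.mulLeft η)]
  have h : ∀ ε : Fin n → ℤˣ, ((((Equiv.mulLeft η) ε i : ℤˣ) : ℤ) : ℝ) *
      rieszProductIm b (η * (Equiv.mulLeft η) ε) =
      ((η i : ℤ) : ℝ) * (((ε i : ℤ) : ℝ) * rieszProductIm b ε) := fun ε ↦ by
    have h2 : η * η = 1 := by ext j; simp [Int.units_mul_self]
    rw [Equiv.coe_mulLeft, ← mul_assoc, h2, one_mul]
    simp only [Pi.mul_apply, Units.val_mul]
    push_cast
    ring
  rw [Finset.sum_congr rfl fun ε _ ↦ h ε, ← Finset.mul_sum, sum_sign_mul_rieszProductIm]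
  ring

end Signs

/-! ### Khinchine's inequality in a vector lattice. -/

section Khinchine

variable {G : Type*} [AddCommGroup G] [Module ℝ G] [Lattice G] [IsOrderedAddMonoid G]
  [IsOrderedModule ℝ G]

/-- A Khinchine-type lower bound, as an inequality between elements of a vector lattice. -/
theorem sum_abs_smul_le_sum_abs_signs {n : ℕ} (b : Fin n → ℝ) (x : Fin n → G) :
    ∑ i, |((2 : ℝ) ^ n * b i) • x i| ≤
      (∏ j, √(1 + b j ^ 2)) • ∑ ε : Fin n → ℤˣ, |∑ i, ε i • x i| := by
  refine sum_abs_le_of_forall_units_smul _ _ _ fun η ↦ ?_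
  -- Rotating the Riesz product by `η` realises any signed sum as a combination of the sums `∑ εᵢ
  -- xᵢ`, with coefficients bounded independently of `η`.
  have h1 : ∑ i, η i • ((2 : ℝ) ^ n * b i) • x i =
      ∑ ε : Fin n → ℤˣ, rieszProductIm b (η * ε) • ∑ i, ε i • x i := by
    simp only [Finset.smul_sum, units_int_smul_eq (V := G), smul_smul]
    rw [Finset.sum_comm]
    refine Finset.sum_congr rfl fun i _ ↦ ?_
    rw [← Finset.sum_smul]
    congr 1
    simp only [mul_comm (rieszProductIm _ _)]
    rw [sum_sign_mul_rieszProductIm_mul]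
    ring
  rw [h1, Finset.smul_sum]
  refine Finset.sum_le_sum fun ε _ ↦ (le_abs_self _).trans ?_
  rw [lattice_abs_smul]
  exact smul_le_smul_of_nonneg_right (abs_rieszProductIm_le _ _) (abs_nonneg _)

end Khinchine

/-! ### Lower `ℓ²` estimate from a positive functional. -/

section KhinchineFunctional

variable {E : Type*} [NormedAddCommGroup E] [NormedSpace ℝ E]
    [Lattice E] [IsOrderedAddMonoid E] [IsOrderedModule ℝ E] [HasSolidNorm E]

/-- Apply `φ` to the lattice Khinchine inequality with `bᵢ = aᵢ / L`, where `L` is the `ℓ²` norm of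
`a`. Then `∑ bᵢ² = 1`, so the Riesz product is bounded by `e`, and the left side becomes at least `2
^ n * c * L`. -/
theorem sqrt_sum_sq_le_signAvg_norm (φ : StrongDual ℝ E) (hφ : ∀ x, 0 ≤ x → 0 ≤ φ x) {c : ℝ}
    (hc : 0 < c) {n : ℕ} (x : Fin n → E) (hx : ∀ i, c ≤ φ |x i|) (a : Fin n → ℝ) :
    c * √(∑ i, a i ^ 2) ≤ Real.exp 1 * ‖φ‖ * signAvg fun ε ↦ ‖∑ i, ε i • a i • x i‖ := by
  set L := √(∑ i, a i ^ 2) with hL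
  have hR : 0 ≤ Real.exp 1 * ‖φ‖ * signAvg fun ε ↦ ‖∑ i, ε i • a i • x i‖ :=
    mul_nonneg (by positivity) (le_signAvg_of_le fun _ ↦ norm_nonneg _)
  have hsum : 0 ≤ ∑ i, a i ^ 2 := Finset.sum_nonneg fun i _ ↦ sq_nonneg _
  have hLs : L ^ 2 = ∑ i, a i ^ 2 := Real.sq_sqrt hsum
  rcases (show 0 ≤ L from Real.sqrt_nonneg _).eq_or_lt with h0 | hpos
  · rw [← h0, mul_zero]; exact hR
  have hφm : ∀ y z : E, y ≤ z → φ y ≤ φ z := fun y z h ↦ by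
    have := hφ _ (sub_nonneg.2 h)
    rwa [map_sub, sub_nonneg] at this
  have hprod : ∏ j, √(1 + (a j / L) ^ 2) ≤ Real.exp 1 := by
    calc ∏ j, √(1 + (a j / L) ^ 2) ≤ ∏ j, Real.exp ((a j / L) ^ 2) := by
          refine Finset.prod_le_prod (fun _ _ ↦ Real.sqrt_nonneg _) fun j _ ↦ ?_
          have h1 : 1 ≤ 1 + (a j / L) ^ 2 := le_add_of_nonneg_right (sq_nonneg _)
          calc √(1 + (a j / L) ^ 2) ≤ 1 + (a j / L) ^ 2 :=
                Real.sqrt_le_iff.2 ⟨by linarith, by nlinarith⟩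
            _ ≤ Real.exp ((a j / L) ^ 2) := by
                rw [add_comm]; exact Real.add_one_le_exp _
      _ = Real.exp 1 := by
          rw [← Real.exp_sum]
          congr 1
          simp only [div_pow]
          rw [← Finset.sum_div, hLs, div_self]
          rw [← hLs]; positivity
  have h1 := hφm _ _ (sum_abs_smul_le_sum_abs_signs (fun i ↦ a i / L) fun i ↦ a i • x i)
  rw [map_sum, map_smul, map_sum, smul_eq_mul] at h1
  have h2 : ∀ i, 2 ^ n * (c * (a i ^ 2 / L)) ≤ φ |((2 : ℝ) ^ n * (a i / L)) • a i • x i| := by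
    intro i
    rw [smul_smul, lattice_abs_smul, map_smul, smul_eq_mul]
    have : |2 ^ n * (a i / L) * a i| = 2 ^ n * (a i ^ 2 / L) := by
      rw [abs_of_nonneg]
      · ring
      · have : 2 ^ n * (a i / L) * a i = 2 ^ n * (a i ^ 2 / L) := by ring
        rw [this]; positivity
    rw [this]
    have := mul_le_mul_of_nonneg_left (hx i) (show 0 ≤ 2 ^ n * (a i ^ 2 / L) by positivity)
    linarith
  have h3 : ∑ ε : Fin n → ℤˣ, φ |∑ i, ε i • a i • x i| ≤
      ∑ ε : Fin n → ℤˣ, ‖φ‖ * ‖∑ i, ε i • a i • x i‖ := by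
    refine Finset.sum_le_sum fun ε _ ↦ (le_abs_self _).trans ?_
    have := φ.le_opNorm |∑ i, ε i • a i • x i|
    rwa [norm_abs_eq_norm] at this
  have h3' : 0 ≤ ∑ ε : Fin n → ℤˣ, φ |∑ i, ε i • a i • x i| :=
    Finset.sum_nonneg fun ε _ ↦ hφ _ (abs_nonneg _)
  have h4 : 2 ^ n * (c * L) ≤ Real.exp 1 * (‖φ‖ * ∑ ε : Fin n → ℤˣ, ‖∑ i, ε i • a i • x i‖) := by
    calc 2 ^ n * (c * L) = ∑ i, 2 ^ n * (c * (a i ^ 2 / L)) := by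
          rw [← Finset.mul_sum, ← Finset.mul_sum, ← Finset.sum_div, ← hLs]
          field_simp
      _ ≤ _ := Finset.sum_le_sum fun i _ ↦ h2 i
      _ ≤ _ := h1
      _ ≤ Real.exp 1 * ∑ ε : Fin n → ℤˣ, φ |∑ i, ε i • a i • x i| :=
          mul_le_mul_of_nonneg_right hprod h3'
      _ ≤ _ := mul_le_mul_of_nonneg_left (by rwa [Finset.mul_sum]) (Real.exp_pos 1).le
  rw [signAvg, mul_div_assoc', le_div_iff₀ (by positivity)]
  linarith

end KhinchineFunctional

/-! ### Positive norming functionals. -/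

section PositiveFunctional

variable {E : Type*} [NormedAddCommGroup E] [NormedSpace ℝ E]
    [Lattice E] [IsOrderedAddMonoid E] [IsOrderedModule ℝ E] [HasSolidNorm E]

/-- Hahn–Banach with the sublinear majorant `x ↦ ‖x⁺‖`, which vanishes on negative elements and
therefore forces positivity of the extension. -/
theorem exists_positive_norming (y : E) (hy : 0 ≤ y) :
    ∃ φ : E →ₗ[ℝ] ℝ, (∀ x, 0 ≤ x → 0 ≤ φ x) ∧ (∀ x, φ x ≤ ‖x‖) ∧ φ y = ‖y‖ := by
  rcases eq_or_ne y 0 with rfl | hy0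
  · exact ⟨0, by simp, by simp, by simp⟩
  have hpos : ∀ t : ℝ, 0 ≤ t → ∀ x : E, (t • x)⁺ = t • x⁺ := fun t ht x ↦ by
    rw [posPart_def, posPart_def, smul_sup_of_nonneg ht, smul_zero]
  obtain ⟨g, hg1, hg2⟩ := exists_extension_of_le_sublinear
    (LinearPMap.mkSpanSingleton y ‖y‖ hy0) (fun x ↦ ‖x⁺‖)
    (fun c hc x ↦ by rw [hpos c hc.le, norm_smul, Real.norm_of_nonneg hc.le])
    (fun x z ↦ (norm_le_norm_of_nonneg_of_le (posPart_nonneg _) (posPart_add_le x z)).trans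
      (norm_add_le _ _))
    (by
      rintro ⟨x, hx⟩
      obtain ⟨t, rfl⟩ := Submodule.mem_span_singleton.1 hx
      have h := LinearPMap.mkSpanSingleton'_apply y ‖y‖
        (fun c hc ↦ by rw [(smul_eq_zero.1 hc).resolve_right hy0, map_zero, zero_smul]) t hx
      refine (le_of_eq h).trans ?_
      rw [smul_eq_mul, RingHom.id_apply]
      rcases le_total 0 t with ht | ht
      · simp only
        rw [hpos t ht, norm_smul, Real.norm_of_nonneg ht, posPart_eq_self.2 hy]
      · exact (mul_nonpos_of_nonpos_of_nonneg ht (norm_nonneg _)).trans (norm_nonneg _))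
  refine ⟨g, fun x hx ↦ ?_, fun x ↦ (hg2 x).trans ?_, ?_⟩
  · have := hg2 (-x)
    rw [map_neg, posPart_eq_zero.2 (neg_nonpos.2 hx), norm_zero] at this
    linarith
  · refine norm_le_norm_of_abs_le_abs ?_
    rw [abs_of_nonneg (posPart_nonneg x), posPart_def]
    exact sup_le (le_abs_self x) (abs_nonneg x)
  · have := hg1 ⟨y, Submodule.mem_span_singleton_self y⟩
    rw [this]
    exact LinearPMap.mkSpanSingleton_apply ℝ ℝ hy0 ‖y‖

end PositiveFunctional

/-! ### Finite cotype and dominating measures on partitions. -/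

section Cotype

/-- `M` is a cotype `q` constant of `X`. -/
def HasCotypeWith (X : Type*) [NormedAddCommGroup X] (q M : ℝ) : Prop :=
  ∀ (n : ℕ) (x : Fin n → X),
    (∑ i, ‖x i‖ ^ q) ^ (1 / q) ≤ M * ((∑ ε : Fin n → ℤˣ, ‖∑ i, ε i • x i‖) / 2 ^ n)

theorem HasCotype.exists_nonneg {X : Type*} [NormedAddCommGroup X] {q : ℝ} (h : HasCotype X q) :
    ∃ M : ℝ, 0 ≤ M ∧ HasCotypeWith X q M := by
  obtain ⟨M, hM⟩ := h
  exact ⟨|M|, abs_nonneg M, fun n x ↦ (hM n x).trans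
    (mul_le_mul_of_nonneg_right (le_abs_self M) (by positivity))⟩

/-- The convex function `t ↦ t ^ q` lies above its tangent at `s`; after scaling by `s` this is
Bernoulli's inequality. -/
theorem rpow_sub_rpow_le {q s r : ℝ} (hq : 1 ≤ q) (hs : 0 ≤ s) (hr : 0 ≤ r) :
    s ^ q - r ^ q ≤ q * s ^ (q - 1) * (s - r) := by
  rcases hs.eq_or_lt with rfl | hs
  · rw [Real.zero_rpow (by linarith)]
    rcases hq.eq_or_lt with rfl | hq
    · simp
    · rw [Real.zero_rpow (by linarith)]
      simpa using Real.rpow_nonneg hr q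
  have h1 : r ^ q = s ^ q * (1 + (r / s - 1)) ^ q := by
    rw [← Real.mul_rpow hs.le (by simp; positivity)]
    congr 1
    field_simp
    ring
  have h2 := one_add_mul_self_le_rpow_one_add (s := r / s - 1) (p := q)
    (by have := div_nonneg hr hs.le; linarith) hq
  have h3 : s ^ q = s ^ (q - 1) * s := by
    rw [← Real.rpow_add_one hs.ne']; congr 1; ring
  have h4 := mul_le_mul_of_nonneg_left h2 (Real.rpow_nonneg hs.le q)
  rw [← h1] at h4
  have h5 : s ^ q * (1 + q * (r / s - 1)) = s ^ q + q * s ^ (q - 1) * (r - s) := by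
    rw [h3]; field_simp; 
  linarith

theorem rpow_sub_one_mul_self {q s : ℝ} (hq : 1 ≤ q) (hs : 0 ≤ s) : s ^ (q - 1) * s = s ^ q := by
  rcases hs.eq_or_lt with rfl | hs
  · rw [mul_zero, Real.zero_rpow (by linarith)]
  · rw [← Real.rpow_add_one hs.ne']; congr 1; ring

variable {E : Type*} [NormedAddCommGroup E] [NormedSpace ℝ E]
    [Lattice E] [IsOrderedAddMonoid E] [IsOrderedModule ℝ E] [HasSolidNorm E]

-- Every signed sum is bounded in modulus by `∑ |xᵢ| ≤ z`, so cotype becomes a lower `q`-estimate.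
omit [NormedSpace ℝ E] [IsOrderedModule ℝ E] in
theorem HasCotypeWith.sum_rpow_le {q M : ℝ} (hM : HasCotypeWith E q M) (hM0 : 0 ≤ M) (hq : 1 ≤ q)
    {ι : Type*} [Fintype ι] (x : ι → E) {z : E} (hx : ∑ i, |x i| ≤ z) :
    ∑ i, ‖x i‖ ^ q ≤ (M * ‖z‖) ^ q := by
  have hq0 : 0 < q := by linarith
  set e := Fintype.equivFin ι
  have h1 := hM (Fintype.card ι) (x ∘ e.symm)
  have h2 : signAvg (fun ε : Fin (Fintype.card ι) → ℤˣ ↦ ‖∑ i, ε i • (x ∘ e.symm) i‖) ≤ ‖z‖ := by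
    refine signAvg_le_of_le fun ε ↦ norm_le_norm_of_abs_le (le_trans ?_ hx)
    refine (lattice_abs_sum_le _ _).trans ?_
    rw [← Equiv.sum_comp e.symm]
    refine Finset.sum_le_sum fun i _ ↦ ?_
    rcases Int.units_eq_one_or (ε i) with h | h <;> simp [h]
  have h3 : (∑ i, ‖x i‖ ^ q) = ∑ i, ‖(x ∘ e.symm) i‖ ^ q := by
    rw [← Equiv.sum_comp e.symm]; rfl
  rw [h3]
  have h4 : 0 ≤ ∑ i, ‖(x ∘ e.symm) i‖ ^ q :=
    Finset.sum_nonneg fun i _ ↦ Real.rpow_nonneg (norm_nonneg _) _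
  have h5 := Real.rpow_le_rpow (Real.rpow_nonneg h4 _)
    (h1.trans (mul_le_mul_of_nonneg_left h2 hM0)) hq0.le
  rwa [← Real.rpow_mul h4, one_div, inv_mul_cancel₀ hq0.ne', Real.rpow_one] at h5

/-- The Maurey–Pisier factorization for a finite partition of `u`: the map
`B ↦ ‖∑ k ∈ B, w k‖ ^ q` is dominated by a measure of controlled mass. -/
theorem HasCotypeWith.exists_dominating_weights {q M : ℝ} (hM : HasCotypeWith E q M) (hM0 : 0 ≤ M)
    (hq : 1 ≤ q) {κ : Type*} [Fintype κ] {w : κ → E} (hw : ∀ k, 0 ≤ w k) {u : E}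
    (hwu : ∑ k, w k = u) :
    ∃ μ : κ → ℝ, (∀ k, 0 ≤ μ k) ∧ ∑ k, μ k ≤ q * (M * ‖u‖) ^ q ∧
      ∀ B : Finset κ, ‖∑ k ∈ B, w k‖ ^ q ≤ ∑ k ∈ B, μ k := by
  classical
  -- A colouring `g` groups the pieces into blocks `P g l`. There is one colour more than there are
  -- pieces, so a colour is always free. The weights linearise `∑ ‖P g l‖ ^ q` at a colouring
  -- maximising it.
  let P : (κ → Option κ) → Option κ → E := fun g l ↦ ∑ k with g k = l, w k
  have hP0 : ∀ g l, 0 ≤ P g l := fun g l ↦ Finset.sum_nonneg fun k _ ↦ hw k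
  obtain ⟨g, hg⟩ := Finite.exists_max fun g : κ → Option κ ↦ ∑ l, ‖P g l‖ ^ q
  choose φ hφ0 hφle hφeq using fun l ↦ exists_positive_norming (P g l) (hP0 g l)
  refine ⟨fun k ↦ q * ‖P g (g k)‖ ^ (q - 1) * φ (g k) (w k), fun k ↦ ?_, ?_, fun B ↦ ?_⟩
  · exact mul_nonneg (mul_nonneg (by linarith) (Real.rpow_nonneg (norm_nonneg _) _))
      (hφ0 _ _ (hw k))
  · rw [← Finset.sum_fiberwise Finset.univ g]
    have h1 : ∀ l, ∑ k with g k = l, q * ‖P g (g k)‖ ^ (q - 1) * φ (g k) (w k) =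
        q * ‖P g l‖ ^ q := fun l ↦ by
      rw [Finset.sum_congr rfl (g := fun k ↦ q * ‖P g l‖ ^ (q - 1) * φ l (w k)) fun k hk ↦ by
        rw [(Finset.mem_filter.1 hk).2], ← Finset.mul_sum, ← map_sum, hφeq, mul_assoc,
        rpow_sub_one_mul_self hq (norm_nonneg _)]
    rw [Finset.sum_congr rfl fun l _ ↦ h1 l, ← Finset.mul_sum]
    refine mul_le_mul_of_nonneg_left (hM.sum_rpow_le hM0 hq _ ?_) (by linarith)
    rw [Finset.sum_congr rfl fun l _ ↦ abs_of_nonneg (hP0 g l), Finset.sum_fiberwise, hwu]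
  · have hns : ¬ Function.Surjective g := fun hs ↦ by
      have := Fintype.card_le_of_surjective g hs
      rw [Fintype.card_option] at this
      omega
    obtain ⟨l₀, hl₀⟩ := not_forall.1 hns
    have hl₀ : ∀ k, g k ≠ l₀ := fun k hk ↦ hl₀ ⟨k, hk⟩
    -- Recolour `B` with the free colour. By maximality the new block's `‖·‖ ^ q` is at most what
    -- the other blocks lose, and the tangent inequality bounds this loss by the weight of `B`.
    set g' : κ → Option κ := fun k ↦ if k ∈ B then l₀ else g k with hg'
    let I : Option κ → E := fun l ↦ ∑ k ∈ B with g k = l, w k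
    have e1 : P g' l₀ = ∑ k ∈ B, w k := by
      refine Finset.sum_congr ?_ fun _ _ ↦ rfl
      ext k
      by_cases hk : k ∈ B <;> simp [hg', hk, hl₀]
    have e2 : P g l₀ = 0 := by
      refine Finset.sum_eq_zero fun k hk ↦ absurd (Finset.mem_filter.1 hk).2 (hl₀ k)
    have e3 : ∀ l, l ≠ l₀ → P g l = I l + P g' l := fun l hl ↦ by
      simp only [P, I]
      rw [← Finset.sum_filter_add_sum_filter_not (Finset.univ.filter (g · = l)) (· ∈ B)]
      congr 1
      · refine Finset.sum_congr ?_ fun _ _ ↦ rfl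
        ext k; simp [and_comm]
      · refine Finset.sum_congr ?_ fun _ _ ↦ rfl
        ext k
        by_cases hk : k ∈ B <;> simp [hg', hk, hl.symm]
    have h1 := hg g'
    rw [← Finset.add_sum_erase _ _ (Finset.mem_univ l₀),
      ← Finset.add_sum_erase _ (fun l ↦ ‖P g l‖ ^ q) (Finset.mem_univ l₀), e1, e2, norm_zero,
      Real.zero_rpow (by linarith), zero_add] at h1
    have h2 : ∀ l ∈ Finset.univ.erase l₀, ‖P g l‖ ^ q ≤
        ‖P g' l‖ ^ q + q * ‖P g l‖ ^ (q - 1) * φ l (I l) := fun l hl ↦ by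
      have h3 := rpow_sub_rpow_le hq (norm_nonneg (P g l)) (norm_nonneg (P g' l))
      have h4 : ‖P g l‖ - ‖P g' l‖ ≤ φ l (I l) := by
        rw [← hφeq, e3 l (Finset.ne_of_mem_erase hl), map_add]
        linarith [hφle l (P g' l)]
      have h5 := mul_le_mul_of_nonneg_left h4 (mul_nonneg (by linarith : 0 ≤ q)
        (Real.rpow_nonneg (norm_nonneg (P g l)) (q - 1)))
      linarith
    have h3 := h1.trans (Finset.sum_le_sum h2)
    rw [Finset.sum_add_distrib, add_comm, add_le_add_iff_left] at h3
    refine h3.trans (le_trans (Finset.sum_le_univ_sum_of_nonneg fun l ↦ ?_) (le_of_eq ?_))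
    · exact mul_nonneg (mul_nonneg (by linarith) (Real.rpow_nonneg (norm_nonneg _) _))
        (hφ0 _ _ (Finset.sum_nonneg fun k _ ↦ hw k))
    · rw [← Finset.sum_fiberwise B g]
      refine Finset.sum_congr rfl fun l _ ↦ ?_
      rw [Finset.sum_congr rfl (g := fun k ↦ q * ‖P g l‖ ^ (q - 1) * φ l (w k)) fun k hk ↦ by
        rw [(Finset.mem_filter.1 hk).2], ← Finset.mul_sum, ← map_sum]

end Cotype

/-! ### Subgaussian tails of Rademacher sums and a discrete layer-cake bound. -/

section SignTail

/-- By independence the average factors into `∏ cosh tᵢ`, and `cosh t ≤ exp (t² / 2)`. -/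
theorem signAvg_exp_le {n : ℕ} (t : Fin n → ℝ) (ht : ∑ i, t i ^ 2 ≤ 1) :
    signAvg (fun ε : Fin n → ℤˣ ↦ Real.exp (∑ i, (ε i : ℤ) * t i)) ≤ 2 := by
  have h1 : signAvg (fun ε : Fin n → ℤˣ ↦ Real.exp (∑ i, (ε i : ℤ) * t i)) =
      ∏ i, Real.cosh (t i) := by
    have h2 : ∀ j : Fin n, Real.exp ((((1 : ℤˣ) : ℤ) : ℝ) * t j) +
        Real.exp ((((-1 : ℤˣ) : ℤ) : ℝ) * t j) = Real.cosh (t j) * 2 := fun j ↦ by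
      rw [Real.cosh_eq]; simp
    rw [signAvg, Finset.sum_congr rfl fun ε _ ↦ Real.exp_sum Finset.univ _,
      sum_prod_signs fun i e ↦ Real.exp (((e : ℤ) : ℝ) * t i),
      Finset.prod_congr rfl fun j _ ↦ h2 j, Finset.prod_mul_distrib, Finset.prod_const,
      Finset.card_univ, Fintype.card_fin, mul_div_cancel_right₀ _ (by positivity)]
  rw [h1]
  calc ∏ i, Real.cosh (t i) ≤ ∏ i, Real.exp (t i ^ 2 / 2) :=
        Finset.prod_le_prod (fun i _ ↦ (Real.cosh_pos _).le) fun i _ ↦ Real.cosh_le_exp_half_sq _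
    _ = Real.exp ((∑ i, t i ^ 2) / 2) := by rw [← Real.exp_sum, Finset.sum_div]
    _ ≤ Real.exp (1 / 2) := Real.exp_le_exp.2 (by linarith)
    _ ≤ 2 := by
        have h2 : Real.exp (1 / 2) * Real.exp (1 / 2) = Real.exp 1 := by
          rw [← Real.exp_add]; norm_num
        nlinarith [Real.exp_one_lt_d9, Real.exp_pos (1 / 2)]

/-- Exponential Markov inequality applied to the sum and to its negative. -/
theorem signAvg_indicator_le {n : ℕ} (t : Fin n → ℝ) (ht : ∑ i, t i ^ 2 ≤ 1) (s : ℝ) :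
    signAvg (fun ε : Fin n → ℤˣ ↦ if s ≤ |∑ i, (ε i : ℤ) * t i| then 1 else 0) ≤
      4 * Real.exp (-s) := by
  have h1 : ∀ ε : Fin n → ℤˣ, (if s ≤ |∑ i, (ε i : ℤ) * t i| then (1 : ℝ) else 0) ≤
      Real.exp (-s) * (Real.exp (∑ i, (ε i : ℤ) * t i) +
        Real.exp (∑ i, (ε i : ℤ) * (-t i))) := fun ε ↦ by
    simp only [mul_neg, Finset.sum_neg_distrib]
    set r := ∑ i, ((ε i : ℤ) : ℝ) * t i
    split_ifs with h
    · rw [mul_add, ← Real.exp_add, ← Real.exp_add]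
      rcases le_abs'.1 h with h | h
      · have : 1 ≤ Real.exp (-s + -r) := Real.one_le_exp (by linarith)
        linarith [Real.exp_pos (-s + r)]
      · have : 1 ≤ Real.exp (-s + r) := Real.one_le_exp (by linarith)
        linarith [Real.exp_pos (-s + -r)]
    · positivity
  refine (signAvg_mono h1).trans ?_
  rw [signAvg_const_mul, signAvg_add]
  have h2 := signAvg_exp_le t ht
  have h3 := signAvg_exp_le (fun i ↦ -t i) (by simpa using ht)
  nlinarith [Real.exp_pos (-s)]

theorem signAvg_le_rpow {n : ℕ} {q : ℝ} (hq : 1 ≤ q) {F : (Fin n → ℤˣ) → ℝ} (hF : ∀ ε, 0 ≤ F ε)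
    {c : ℝ} (h : signAvg (fun ε ↦ F ε ^ q) ≤ c) : signAvg F ≤ c ^ (1 / q) := by
  have hq0 : 0 < q := by linarith
  have h0 : 0 ≤ signAvg F := le_signAvg_of_le hF
  have h1 := Real.rpow_arith_mean_le_arith_mean_rpow Finset.univ
    (fun _ : Fin n → ℤˣ ↦ 1 / (2 : ℝ) ^ n) F (fun _ _ ↦ by positivity)
    (by rw [Finset.sum_const, Finset.card_univ, card_signs, nsmul_eq_mul]; push_cast; field_simp)
    (fun ε _ ↦ hF ε) hq
  rw [← Finset.mul_sum, ← Finset.mul_sum, one_div_mul_eq_div, one_div_mul_eq_div] at h1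
  have h2 : signAvg F ^ q ≤ c := h1.trans h
  have h3 := Real.rpow_le_rpow (Real.rpow_nonneg h0 q) h2 (one_div_nonneg.2 hq0.le)
  rwa [← Real.rpow_mul h0, mul_one_div_cancel hq0.ne', Real.rpow_one] at h3

theorem le_one_add_sum_indicator {t : ℝ} (J : ℕ) (hJ : t ≤ J) :
    t ≤ 1 + ∑ j ∈ Finset.range J, if (j : ℝ) + 1 ≤ t then (1 : ℝ) else 0 := by
  induction J with
  | zero => simp at hJ ⊢; linarith
  | succ J ih =>
    by_cases h : t ≤ J
    · refine (ih h).trans ?_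
      rw [Finset.sum_range_succ]
      have : (0 : ℝ) ≤ if (J : ℝ) + 1 ≤ t then (1 : ℝ) else 0 := by split_ifs <;> norm_num
      linarith
    · have h1 : (J : ℝ) ≤ ∑ j ∈ Finset.range J, if (j : ℝ) + 1 ≤ t then (1 : ℝ) else 0 := by
        rw [Finset.sum_congr rfl (g := fun _ ↦ (1 : ℝ)) fun j hj ↦ if_pos ?_]
        · simp
        · have : (j : ℝ) + 1 ≤ J := by exact_mod_cast Finset.mem_range.1 hj
          linarith
      rw [Finset.sum_range_succ]
      have : (0 : ℝ) ≤ if (J : ℝ) + 1 ≤ t then (1 : ℝ) else 0 := by split_ifs <;> norm_num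
      push_cast at hJ
      linarith

end SignTail

/-! ### Consequences of cotype on an order interval: upper `ℓ²` estimate and a detecting functional.
-/

section UpperEstimate

variable {E : Type*} [NormedAddCommGroup E] [NormedSpace ℝ E]
    [Lattice E] [IsOrderedAddMonoid E] [IsOrderedModule ℝ E] [HasSolidNorm E]

/-- On a common partition of `u` every `hᵢ` has coefficients `±1`, so `∑ εᵢ aᵢ hᵢ` has scalar
Rademacher sums as coefficients. Slicing these by size reduces the norm to those of partial sums
over level sets. The dominating weights turn `q`-th powers of these norms into measures, whose
averages decay exponentially by the tail bound. -/
theorem HasCotypeWith.signAvg_norm_le_of_sum_sq_le_one {q M : ℝ} (hM : HasCotypeWith E q M)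
    (hM0 : 0 ≤ M) (hq : 1 ≤ q) {u : E} (hu : 0 ≤ u) {n : ℕ} (h : Fin n → E) (hh : ∀ i, |h i| ≤ u)
    (a : Fin n → ℝ) (ha : ∑ i, a i ^ 2 ≤ 1) :
    signAvg (fun ε : Fin n → ℤˣ ↦ ‖∑ i, ε i • a i • h i‖) ≤
      ‖u‖ + (4 * (q * (M * ‖u‖) ^ q)) ^ (1 / q) * ∑' j : ℕ, Real.exp (-(1 / q)) ^ j := by
  classical
  have hq0 : 0 < q := by linarith
  set Q := q * (M * ‖u‖) ^ q with hQ
  have hQ0 : 0 ≤ Q := by positivity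
  -- The affine map `h ↦ (h + u) / 2` carries `[-u, u]` to `[0, u]`; undoing it turns the subsum
  -- over `A i` into signs, `+` on `A i` and `-` off it.
  obtain ⟨κ, _, w, A, hw, hwu, hA⟩ := exists_common_partition hu Finset.univ
    (fun i ↦ (1 / 2 : ℝ) • (h i + u)) fun i _ ↦ by
      obtain ⟨h1, h2⟩ := abs_le'.1 (hh i)
      refine ⟨smul_nonneg (by norm_num) (neg_le_iff_add_nonneg'.1 (by simpa using h2)), ?_⟩
      calc (1 / 2 : ℝ) • (h i + u) ≤ (1 / 2 : ℝ) • (u + u) :=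
            smul_le_smul_of_nonneg_left (add_le_add_left h1 u) (by norm_num)
        _ = u := by rw [← two_smul ℝ u, smul_smul]; norm_num
  obtain ⟨μ, hμ0, hμQ, hμ⟩ := hM.exists_dominating_weights hM0 hq hw hwu
  let c : Fin n → κ → ℝ := fun i k ↦ if k ∈ A i then 1 else -1
  have hc : ∀ i k, c i k ^ 2 = 1 := fun i k ↦ by simp only [c]; split_ifs <;> norm_num
  have hhc : ∀ i, h i = ∑ k, c i k • w k := fun i ↦ by
    have h1 : ∀ k, c i k • w k = (2 : ℝ) • (if k ∈ A i then w k else 0) - w k := fun k ↦ by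
      simp only [c]
      split_ifs
      · rw [two_smul, one_smul, add_sub_cancel_right]
      · simp
    rw [Finset.sum_congr rfl fun k _ ↦ h1 k, Finset.sum_sub_distrib, ← Finset.smul_sum,
      Finset.sum_ite_mem, Finset.univ_inter, ← hA i (Finset.mem_univ _), hwu, smul_smul]
    norm_num
  let r : (Fin n → ℤˣ) → κ → ℝ := fun ε k ↦ ∑ i, (ε i : ℤ) * (a i * c i k)
  have hr : ∀ ε : Fin n → ℤˣ, ∑ i, ε i • a i • h i = ∑ k, r ε k • w k := fun ε ↦ by
    simp only [hhc, units_int_smul_eq (V := E), Finset.smul_sum, smul_smul, r, Finset.sum_smul]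
    rw [Finset.sum_comm]
  obtain ⟨J, hJ⟩ := exists_nat_ge (∑ i, |a i|)
  have hrJ : ∀ ε k, |r ε k| ≤ J := fun ε k ↦ by
    refine ((Finset.abs_sum_le_sum_abs _ _).trans (Finset.sum_le_sum fun i _ ↦ ?_)).trans hJ
    have h1 : |c i k| = 1 := by rw [← sq_eq_sq₀ (abs_nonneg _) zero_le_one, sq_abs, hc]; norm_num
    rw [abs_mul, abs_mul, h1, mul_one]
    rcases Int.units_eq_one_or (ε i) with h | h <;> simp [h]
  let B : (Fin n → ℤˣ) → ℕ → Finset κ := fun ε j ↦ Finset.univ.filter fun k ↦ (j : ℝ) + 1 ≤ |r ε k|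
  have hnorm : ∀ ε : Fin n → ℤˣ, ‖∑ i, ε i • a i • h i‖ ≤
      ‖u‖ + ∑ j ∈ Finset.range J, ‖∑ k ∈ B ε j, w k‖ := fun ε ↦ by
    rw [hr]
    have h1 : |∑ k, r ε k • w k| ≤ u + ∑ j ∈ Finset.range J, ∑ k ∈ B ε j, w k := by
      calc |∑ k, r ε k • w k| ≤ ∑ k, |r ε k| • w k := by
            refine (lattice_abs_sum_le _ _).trans (Finset.sum_le_sum fun k _ ↦ ?_)
            rw [lattice_abs_smul, abs_of_nonneg (hw k)]
        _ ≤ ∑ k, (1 + ∑ j ∈ Finset.range J, if (j : ℝ) + 1 ≤ |r ε k| then (1 : ℝ) else 0) • w k :=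
            Finset.sum_le_sum fun k _ ↦ smul_le_smul_of_nonneg_right
              (le_one_add_sum_indicator J (hrJ ε k)) (hw k)
        _ = u + ∑ j ∈ Finset.range J, ∑ k ∈ B ε j, w k := by
            simp only [add_smul, one_smul, Finset.sum_add_distrib, hwu, Finset.sum_smul, ite_smul,
              zero_smul, B, Finset.sum_filter]
            rw [Finset.sum_comm]
    refine (norm_le_norm_of_abs_le h1).trans ((norm_add_le _ _).trans ?_)
    gcongr
    exact norm_sum_le _ _
  refine (signAvg_mono hnorm).trans ?_
  rw [signAvg_add, signAvg_const, signAvg_sum]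
  gcongr
  have hB : ∀ j : ℕ, signAvg (fun ε ↦ ‖∑ k ∈ B ε j, w k‖) ≤
      (4 * Q) ^ (1 / q) * Real.exp (-(1 / q)) ^ j := fun j ↦ by
    have h1 : signAvg (fun ε ↦ ‖∑ k ∈ B ε j, w k‖ ^ q) ≤ 4 * Q * Real.exp (-j) := by
      calc signAvg (fun ε ↦ ‖∑ k ∈ B ε j, w k‖ ^ q)
          ≤ signAvg (fun ε ↦ ∑ k, μ k * if (j : ℝ) + 1 ≤ |r ε k| then 1 else 0) := by
            refine signAvg_mono fun ε ↦ (hμ _).trans (le_of_eq ?_)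
            simp [B, Finset.sum_filter]
        _ = ∑ k, μ k * signAvg (fun ε ↦ if (j : ℝ) + 1 ≤ |r ε k| then 1 else 0) := by
            rw [signAvg_sum]
            exact Finset.sum_congr rfl fun k _ ↦ signAvg_const_mul _ _
        _ ≤ ∑ k, μ k * (4 * Real.exp (-j)) := by
            refine Finset.sum_le_sum fun k _ ↦ mul_le_mul_of_nonneg_left ?_ (hμ0 k)
            refine (signAvg_indicator_le (fun i ↦ a i * c i k) ?_ _).trans ?_
            · simpa only [mul_pow, hc, mul_one] using ha
            · gcongr
              linarith
        _ ≤ 4 * Q * Real.exp (-j) := by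
            rw [← Finset.sum_mul]
            calc _ ≤ Q * (4 * Real.exp (-j)) := by gcongr
              _ = _ := by ring
    refine (signAvg_le_rpow hq (fun ε ↦ norm_nonneg _) h1).trans (le_of_eq ?_)
    rw [Real.mul_rpow (by positivity) (Real.exp_pos _).le, ← Real.exp_mul, ← Real.exp_nat_mul]
    congr 2
    ring
  refine (Finset.sum_le_sum fun j _ ↦ hB j).trans ?_
  rw [← Finset.mul_sum]
  gcongr
  refine Summable.sum_le_tsum _ (fun _ _ ↦ by positivity) (summable_geometric_of_lt_one
    (Real.exp_pos _).le ?_)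
  rw [Real.exp_lt_one_iff]
  have : 0 < 1 / q := by positivity
  linarith

/-- In a Banach lattice of finite cotype, signed sums of elements of an order interval satisfy an
upper `ℓ²`-estimate on average. -/
theorem HasCotypeWith.exists_signAvg_norm_le {q M : ℝ} (hM : HasCotypeWith E q M)
    (hM0 : 0 ≤ M) (hq : 1 ≤ q) {u : E} (hu : 0 ≤ u) :
    ∃ C : ℝ, 0 ≤ C ∧ ∀ (n : ℕ) (h : Fin n → E), (∀ i, |h i| ≤ u) → ∀ a : Fin n → ℝ,
      signAvg (fun ε : Fin n → ℤˣ ↦ ‖∑ i, ε i • a i • h i‖) ≤ C * √(∑ i, a i ^ 2) := by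
  have hq0 : 0 < q := by linarith
  refine ⟨‖u‖ + (4 * (q * (M * ‖u‖) ^ q)) ^ (1 / q) * ∑' j : ℕ, Real.exp (-(1 / q)) ^ j,
    ?_, fun n h hh a ↦ ?_⟩
  · have : 0 ≤ ∑' j : ℕ, Real.exp (-(1 / q)) ^ j := tsum_nonneg fun j ↦ by positivity
    positivity
  · set L := √(∑ i, a i ^ 2) with hL
    have hsum : 0 ≤ ∑ i, a i ^ 2 := Finset.sum_nonneg fun i _ ↦ sq_nonneg _
    have hLs : L ^ 2 = ∑ i, a i ^ 2 := Real.sq_sqrt hsum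
    rcases (show 0 ≤ L from Real.sqrt_nonneg _).eq_or_lt with h0 | hpos
    · rw [← h0, zero_pow two_ne_zero, eq_comm,
        Finset.sum_eq_zero_iff_of_nonneg fun i _ ↦ sq_nonneg _] at hLs
      have ha : ∀ i, a i = 0 := fun i ↦ by simpa using hLs i (Finset.mem_univ i)
      simp [ha, signAvg, ← h0]
    · have h1 := hM.signAvg_norm_le_of_sum_sq_le_one hM0 hq hu h hh (fun i ↦ a i / L) (by
        simp only [div_pow]
        rw [← Finset.sum_div, hLs, div_self (by rw [← hLs]; positivity)])
      have h2 : ∀ ε : Fin n → ℤˣ, ‖∑ i, ε i • a i • h i‖ =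
          L * ‖∑ i, ε i • (a i / L) • h i‖ := fun ε ↦ by
        rw [← Real.norm_of_nonneg hpos.le, ← norm_smul, Finset.smul_sum,
          Real.norm_of_nonneg hpos.le]
        congr 1
        refine Finset.sum_congr rfl fun i _ ↦ ?_
        rw [units_int_smul_eq, units_int_smul_eq, smul_smul, smul_smul, smul_smul]
        congr 1
        field_simp
      simp only [h2]
      rw [signAvg_const_mul, mul_comm]
      gcongr

/-- If a convex combination were too small, the set `D` of pieces with total coefficient `m k ≥ p`
would have norm below `δ / 2`. Each `vᵢ` then keeps `μ`-mass at least `(δ / 2) ^ q` off `D`, but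
averaging over `i` bounds this by `p * Q = (δ / 2) ^ q / 2`. The bound does not depend on the number
of elements. -/
theorem HasCotypeWith.exists_le_norm_convex_combination {q M : ℝ} (hM : HasCotypeWith E q M)
    (hM0 : 0 ≤ M) (hq : 1 ≤ q) {u : E} (hu : 0 ≤ u) {δ : ℝ} (hδ : 0 < δ) :
    ∃ δ' : ℝ, 0 < δ' ∧ ∀ {ι : Type} (s : Finset ι) (v : ι → E) (t : ι → ℝ),
      (∀ i ∈ s, 0 ≤ v i ∧ v i ≤ u) → (∀ i ∈ s, δ ≤ ‖v i‖) → (∀ i ∈ s, 0 ≤ t i) →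
      ∑ i ∈ s, t i = 1 → δ' ≤ ‖∑ i ∈ s, t i • v i‖ := by
  classical
  have hq0 : 0 < q := by linarith
  set Q := q * (M * ‖u‖) ^ q + 1 with hQ
  have hQ0 : 0 < Q := by positivity
  set p := (δ / 2) ^ q / (2 * Q) with hp
  have hp0 : 0 < p := by positivity
  refine ⟨p * (δ / 2), by positivity, fun {ι} s v t hv hvδ ht ht1 ↦ ?_⟩
  by_contra! hlt
  obtain ⟨κ, _, w, A, hw, hwu, hA⟩ := exists_common_partition hu s v hv
  obtain ⟨μ, hμ0, hμQ, hμ⟩ := hM.exists_dominating_weights hM0 hq hw hwu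
  set m : κ → ℝ := fun k ↦ ∑ i ∈ s, t i * if k ∈ A i then 1 else 0 with hm
  have hm0 : ∀ k, 0 ≤ m k := fun k ↦
    Finset.sum_nonneg fun i hi ↦ mul_nonneg (ht i hi) (by split_ifs <;> norm_num)
  have hsum : ∑ i ∈ s, t i • v i = ∑ k, m k • w k := by
    simp only [hm, Finset.sum_smul]
    rw [Finset.sum_comm]
    refine Finset.sum_congr rfl fun i hi ↦ ?_
    rw [hA i hi]
    simp only [← smul_smul, ite_smul, one_smul, zero_smul, ← Finset.smul_sum, Finset.sum_ite_mem,
      Finset.univ_inter]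
  let D : Finset κ := Finset.univ.filter fun k ↦ p ≤ m k
  have hD : ‖∑ k ∈ D, w k‖ < δ / 2 := by
    have h1 : p • ∑ k ∈ D, w k ≤ ∑ k, m k • w k := by
      rw [Finset.smul_sum]
      refine (Finset.sum_le_sum fun k hk ↦ ?_).trans
        (Finset.sum_le_univ_sum_of_nonneg fun k ↦ smul_nonneg (hm0 k) (hw k))
      exact smul_le_smul_of_nonneg_right (Finset.mem_filter.1 hk).2 (hw k)
    have h2 := norm_le_norm_of_nonneg_of_le
      (smul_nonneg hp0.le (Finset.sum_nonneg fun k _ ↦ hw k)) h1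
    rw [norm_smul, Real.norm_of_nonneg hp0.le, ← hsum] at h2
    exact lt_of_mul_lt_mul_left (h2.trans_lt hlt) hp0.le
  have hAD : ∀ i ∈ s, (δ / 2) ^ q ≤ ∑ k ∈ A i with k ∉ D, μ k := fun i hi ↦ by
    refine le_trans (Real.rpow_le_rpow (by positivity) ?_ hq0.le) (hμ _)
    have h1 := hvδ i hi
    rw [hA i hi, ← Finset.sum_filter_add_sum_filter_not (A i) (· ∈ D)] at h1
    have h2 : ‖∑ k ∈ A i with k ∈ D, w k‖ ≤ ‖∑ k ∈ D, w k‖ := by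
      refine norm_le_norm_of_nonneg_of_le (Finset.sum_nonneg fun k _ ↦ hw k) ?_
      exact Finset.sum_le_sum_of_subset_of_nonneg
        (fun k hk ↦ (Finset.mem_filter.1 hk).2) fun k _ _ ↦ hw k
    linarith [norm_add_le (∑ k ∈ A i with k ∈ D, w k) (∑ k ∈ A i with k ∉ D, w k)]
  have hkey : (δ / 2) ^ q ≤ p * Q := by
    calc (δ / 2) ^ q = ∑ i ∈ s, t i * (δ / 2) ^ q := by rw [← Finset.sum_mul, ht1, one_mul]
      _ ≤ ∑ i ∈ s, t i * ∑ k ∈ A i with k ∉ D, μ k :=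
          Finset.sum_le_sum fun i hi ↦ mul_le_mul_of_nonneg_left (hAD i hi) (ht i hi)
      _ = ∑ k with k ∉ D, μ k * m k := by
          simp only [hm, Finset.mul_sum]
          rw [Finset.sum_comm]
          refine Finset.sum_congr rfl fun i _ ↦ ?_
          simp only [mul_ite, mul_one, mul_zero]
          rw [← Finset.sum_filter, Finset.filter_filter]
          refine Finset.sum_congr ?_ fun k _ ↦ mul_comm _ _
          ext k; simp [and_comm]
      _ ≤ ∑ k with k ∉ D, μ k * p := by
          refine Finset.sum_le_sum fun k hk ↦ mul_le_mul_of_nonneg_left ?_ (hμ0 k)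
          by_contra! h
          exact (Finset.mem_filter.1 hk).2 (Finset.mem_filter.2 ⟨Finset.mem_univ _, h.le⟩)
      _ ≤ ∑ k, μ k * p := Finset.sum_le_univ_sum_of_nonneg fun k ↦ mul_nonneg (hμ0 k) hp0.le
      _ ≤ p * Q := by
          rw [← Finset.sum_mul, mul_comm]
          gcongr
          linarith
  have : p * Q = (δ / 2) ^ q / 2 := by rw [hp]; field_simp
  have : 0 < (δ / 2) ^ q := by positivity
  linarith

open scoped Pointwise in
/-- In a Banach lattice of finite cotype, order bounded positive elements whose norms are bounded
below are uniformly detected by a single positive functional. -/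
theorem HasCotypeWith.exists_positive_functional {q M : ℝ} (hM : HasCotypeWith E q M)
    (hM0 : 0 ≤ M) (hq : 1 ≤ q) {u : E} (hu : 0 ≤ u) {δ : ℝ} (hδ : 0 < δ) (v : ℕ → E)
    (hv : ∀ n, 0 ≤ v n ∧ v n ≤ u) (hvδ : ∀ n, δ ≤ ‖v n‖) :
    ∃ φ : StrongDual ℝ E, (∀ x, 0 ≤ x → 0 ≤ φ x) ∧ ∃ c : ℝ, 0 < c ∧ ∀ n, c ≤ φ (v n) := by
  obtain ⟨δ', hδ', hconv⟩ := hM.exists_le_norm_convex_combination hM0 hq hu hδ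
  -- Adding the positive cone before separating from a ball makes the separating functional
  -- positive.
  have hK : Convex ℝ (convexHull ℝ (Set.range v) + Set.Ici (0 : E)) :=
    (convex_convexHull ℝ _).add (convex_Ici 0)
  have hdisj : Disjoint (Metric.ball (0 : E) δ') (convexHull ℝ (Set.range v) + Set.Ici (0 : E)) := by
    rw [Set.disjoint_left]
    rintro _ hx ⟨y, hy, z, hz, rfl⟩
    obtain ⟨ι, _, t, f, ht, ht1, hf, rfl⟩ := mem_convexHull_iff_exists_fintype.1 hy
    have hfv : ∀ i, 0 ≤ f i ∧ f i ≤ u := fun i ↦ by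
      obtain ⟨n, hn⟩ := hf i
      rw [← hn]; exact hv n
    have hfδ : ∀ i, δ ≤ ‖f i‖ := fun i ↦ by
      obtain ⟨n, hn⟩ := hf i
      rw [← hn]; exact hvδ n
    have h1 := hconv Finset.univ f t (fun i _ ↦ hfv i) (fun i _ ↦ hfδ i) (fun i _ ↦ ht i) ht1
    have h2 : ‖∑ i, t i • f i‖ ≤ ‖∑ i, t i • f i + z‖ :=
      norm_le_norm_of_nonneg_of_le (Finset.sum_nonneg fun i _ ↦ smul_nonneg (ht i) (hfv i).1)
        (le_add_of_nonneg_right hz)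
    rw [mem_ball_zero_iff] at hx
    exact absurd hx (not_lt.2 (h1.trans h2))
  obtain ⟨φ, s, h1, h2⟩ := geometric_hahn_banach_open (convex_ball 0 δ') Metric.isOpen_ball hK hdisj
  have hs : 0 < s := by simpa using h1 0 (Metric.mem_ball_self hδ')
  have hvK : ∀ n, ∀ z : E, 0 ≤ z → s ≤ φ (v n) + φ z := fun n z hz ↦ by
    rw [← map_add]
    exact h2 _ ⟨v n, subset_convexHull ℝ _ ⟨n, rfl⟩, z, hz, rfl⟩
  refine ⟨φ, fun x hx ↦ ?_, s, hs, fun n ↦ by simpa using hvK n 0 le_rfl⟩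
  by_contra! hneg
  -- At this multiple of `x` the separation inequality reads `s ≤ φ (v 0) - |φ (v 0)|`,
  -- contradicting `0 < s`.
  have h3 := hvK 0 ((|φ (v 0)| / -φ x) • x)
    (smul_nonneg (div_nonneg (abs_nonneg _) (by linarith)) hx)
  rw [map_smul, smul_eq_mul, div_mul_eq_mul_div, div_neg, mul_div_cancel_right₀ _ hneg.ne] at h3
  linarith [le_abs_self (φ (v 0))]

end UpperEstimate

/-! ### Unconditional sequences extracted by block perturbation. -/

section Unconditional

open Filter Topology

variable {X : Type*} [NormedAddCommGroup X] [NormedSpace ℝ X]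

/-- Changing signs of coefficients increases norms of finite sums at most by a factor `K`. -/
def IsSignUnconditionalWith (K : ℝ) (x : ℕ → X) : Prop :=
  ∀ (s : Finset ℕ) (a : ℕ → ℝ) (ε : ℕ → ℤˣ),
    ‖∑ n ∈ s, ε n • a n • x n‖ ≤ K * ‖∑ n ∈ s, a n • x n‖

theorem IsSignUnconditionalWith.comp {K : ℝ} {x : ℕ → X} (h : IsSignUnconditionalWith K x)
    {φ : ℕ → ℕ} (hφ : StrictMono φ) : IsSignUnconditionalWith K (x ∘ φ) := fun s a ε ↦ by
  have := h (s.map ⟨φ, hφ.injective⟩) (Function.extend φ a 0) (Function.extend φ ε 1)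
  simpa only [Finset.sum_map, Function.Embedding.coeFn_mk, hφ.injective.extend_apply] using! this

theorem IsSignUnconditionalWith.fin {K : ℝ} {x : ℕ → X} (h : IsSignUnconditionalWith K x) {n : ℕ}
    (a : Fin n → ℝ) (ε : Fin n → ℤˣ) :
    ‖∑ i, ε i • a i • x i‖ ≤ K * ‖∑ i, a i • x i‖ := by
  have h1 := h (Finset.range n) (fun k ↦ if hk : k < n then a ⟨k, hk⟩ else 0)
    (fun k ↦ if hk : k < n then ε ⟨k, hk⟩ else 1)
  rw [Finset.sum_range, Finset.sum_range] at h1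
  simpa using h1

theorem IsSignUnconditionalWith.signAvg_le {K : ℝ} {x : ℕ → X} (h : IsSignUnconditionalWith K x)
    {n : ℕ} (a : Fin n → ℝ) :
    signAvg (fun ε : Fin n → ℤˣ ↦ ‖∑ i, ε i • a i • x i‖) ≤ K * ‖∑ i, a i • x i‖ :=
  signAvg_le_of_le fun ε ↦ h.fin a ε

theorem IsSignUnconditionalWith.le_signAvg {K : ℝ} {x : ℕ → X} (h : IsSignUnconditionalWith K x)
    {n : ℕ} (a : Fin n → ℝ) :
    ‖∑ i, a i • x i‖ ≤ K * signAvg (fun ε : Fin n → ℤˣ ↦ ‖∑ i, ε i • a i • x i‖) := by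
  rw [← signAvg_const_mul]
  refine le_signAvg_of_le fun ε ↦ ?_
  have h1 := h.fin (fun i ↦ ((ε i : ℤ) : ℝ) * a i) ε
  have h2 : ∀ i, ε i • (((ε i : ℤ) : ℝ) * a i) • x i = a i • x i := fun i ↦ by
    rw [← smul_smul, ← units_int_smul_eq, smul_smul, Int.units_mul_self, one_smul]
  have h3 : ∀ i, (((ε i : ℤ) : ℝ) * a i) • x i = ε i • a i • x i := fun i ↦ by
    rw [← smul_smul, ← units_int_smul_eq]
  rwa [Finset.sum_congr rfl fun i _ ↦ h2 i, Finset.sum_congr rfl fun i _ ↦ h3 i] at h1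

variable {ι : Type*} (b : UnconditionalSchauderBasis ι ℝ X)

/-- Gliding hump: far along the sequence the projection onto the coordinates `G` already used is
small, and a finite `A ⊇ G` captures nearly all of `x n`; the new block is `A \ G`. -/
theorem UnconditionalSchauderBasis.exists_block_subseq (x : ℕ → X)
    (hx : ∀ i, Tendsto (fun n ↦ b.coord i (x n)) atTop (𝓝 0)) (η : ℕ → ℝ) (hη : ∀ k, 0 < η k) :
    ∃ (φ : ℕ → ℕ) (F : ℕ → Finset ι), StrictMono φ ∧ Pairwise (fun j k ↦ Disjoint (F j) (F k)) ∧
      ∀ k, ‖x (φ k) - b.proj (F k) (x (φ k))‖ ≤ η k := by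
  classical
  have step : ∀ (k N : ℕ) (G : Finset ι), ∃ (n : ℕ) (F : Finset ι), N < n ∧ Disjoint F G ∧
      ‖x n - b.proj F (x n)‖ ≤ η k := fun k N G ↦ by
    have h1 : Tendsto (fun n ↦ ‖b.proj G (x n)‖) atTop (𝓝 0) := by
      have : Tendsto (fun n ↦ b.proj G (x n)) atTop (𝓝 0) := by
        simp only [GeneralSchauderBasis.proj_apply]
        rw [show (0 : X) = ∑ i ∈ G, (0 : ℝ) • b i by simp]
        exact tendsto_finsetSum _ fun i _ ↦ (hx i).smul_const _
      simpa using this.norm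
    obtain ⟨n, hn, hNn⟩ := ((h1.eventually_lt_const (half_pos (hη k))).and
      (eventually_gt_atTop N)).exists
    have h2 : Tendsto (fun A ↦ ‖x n - b.proj A (x n)‖) atTop (𝓝 0) := by
      have h3 := b.tendsto_proj (x n)
      rw [SummationFilter.unconditional_filter] at h3
      simpa using ((tendsto_const_nhds (x := x n)).sub h3).norm
    obtain ⟨A, hA, hGA⟩ := ((h2.eventually_lt_const (half_pos (hη k))).and
      (eventually_ge_atTop G)).exists
    refine ⟨n, A \ G, hNn, Finset.sdiff_disjoint, ?_⟩
    have h4 : b.proj A (x n) = b.proj (A \ G) (x n) + b.proj G (x n) := by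
      simp only [GeneralSchauderBasis.proj_apply]
      exact (Finset.sum_sdiff hGA).symm
    calc ‖x n - b.proj (A \ G) (x n)‖ = ‖(x n - b.proj A (x n)) + b.proj G (x n)‖ := by
          rw [h4]; congr 1; abel
      _ ≤ _ := (norm_add_le _ _).trans (by linarith)
  choose n F hn hF hxF using step
  let st : ℕ → ℕ × Finset ι := fun k ↦
    Nat.rec (0, ∅) (fun k s ↦ (n k s.1 s.2, s.2 ∪ F k s.1 s.2)) k
  have hst : ∀ k, st (k + 1) = (n k (st k).1 (st k).2, (st k).2 ∪ F k (st k).1 (st k).2) :=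
    fun k ↦ rfl
  have hmono : Monotone fun k ↦ (st k).2 := monotone_nat_of_le_succ fun k ↦ by
    rw [hst]; exact Finset.subset_union_left
  have hlt : ∀ j k, j < k → Disjoint (F j (st j).1 (st j).2) (F k (st k).1 (st k).2) :=
    fun j k hjk ↦ by
      refine (Finset.disjoint_of_subset_right ?_ (hF k (st k).1 (st k).2)).symm
      refine Finset.Subset.trans ?_ (hmono (Nat.succ_le_of_lt hjk))
      simp only [Nat.succ_eq_add_one, hst]
      exact Finset.subset_union_right
  refine ⟨fun k ↦ n k (st k).1 (st k).2, fun k ↦ F k (st k).1 (st k).2,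
    strictMono_nat_of_lt_succ fun k ↦ ?_, fun j k hjk ↦ ?_, fun k ↦ hxF _ _ _⟩
  · have := hn (k + 1) (st (k + 1)).1 (st (k + 1)).2
    rwa [show (st (k + 1)).1 = n k (st k).1 (st k).2 from rfl] at this
  · rcases lt_or_gt_of_ne hjk with h | h
    · exact hlt j k h
    · exact (hlt k j h).symm

/-- A seminormalized coordinatewise null sequence in a Banach space with an unconditional basis has
an unconditional subsequence. -/
theorem UnconditionalSchauderBasis.exists_unconditional_subseq [CompleteSpace X] (x : ℕ → X)
    (hx : ∀ i, Tendsto (fun n ↦ b.coord i (x n)) atTop (𝓝 0)) {δ : ℝ} (hδ : 0 < δ)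
    (hxδ : ∀ n, δ ≤ ‖x n‖) :
    ∃ φ : ℕ → ℕ, StrictMono φ ∧ ∃ K : ℝ, 0 < K ∧ IsSignUnconditionalWith K (x ∘ φ) := by
  classical
  obtain ⟨K, hK1, hK⟩ : ∃ K : ℝ, 1 ≤ K ∧ ∀ A : Finset ι, ‖b.proj A‖ ≤ K := by
    obtain ⟨C, hC⟩ := UnconditionalSchauderBasis.exists_norm_proj_le b
    exact ⟨max C 1, le_max_right _ _, fun A ↦ (hC A).trans (le_max_left _ _)⟩
  have hK0 : 0 < K := by linarith
  obtain ⟨φ, F, hφ, hF, hxF⟩ := b.exists_block_subseq x hx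
    (fun k ↦ δ / (4 * K) * (1 / 2) ^ (k + 1)) (fun k ↦ by positivity)
  -- The factors are `2 * K` for the disjoint blocks (positive and negative signs separately), then
  -- `3 / 2` and `2` for passing from blocks to the sequence and back.
  refine ⟨φ, hφ, 6 * K, by positivity, ?_⟩
  set y := x ∘ φ with hy
  set w : ℕ → X := fun k ↦ b.proj (F k) (y k) with hw
  have hη : ∀ s : Finset ℕ, ∑ k ∈ s, δ / (4 * K) * (1 / 2 : ℝ) ^ (k + 1) ≤ δ / (4 * K) := by
    intro s
    rw [← Finset.mul_sum]
    refine mul_le_of_le_one_right (by positivity) ?_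
    have h1 : HasSum (fun k : ℕ ↦ (1 / 2 : ℝ) ^ (k + 1)) 1 := by
      have := hasSum_geometric_two.mul_right (1 / 2 : ℝ)
      simpa only [pow_succ, mul_one_div, div_self (two_ne_zero' ℝ)] using this
    exact sum_le_hasSum s (fun k _ ↦ by positivity) h1
  have hproj : ∀ (A s : Finset ℕ) (a : ℕ → ℝ), A ⊆ s →
      ∑ k ∈ A, a k • w k = b.proj (A.biUnion F) (∑ k ∈ s, a k • w k) := by
    intro A s a hAs
    rw [map_sum, ← Finset.sum_subset hAs]
    · refine Finset.sum_congr rfl fun k hk ↦ ?_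
      rw [map_smul, hw, GeneralSchauderBasis.proj_comp,
        Finset.inter_eq_right.2 (Finset.subset_biUnion_of_mem F hk)]
    · intro k hk hkA
      rw [map_smul, hw, GeneralSchauderBasis.proj_comp]
      have : A.biUnion F ∩ F k = ∅ := by
        rw [← Finset.disjoint_iff_inter_eq_empty, Finset.disjoint_biUnion_left]
        exact fun j hj ↦ hF (by rintro rfl; exact hkA hj)
      rw [this, GeneralSchauderBasis.proj_empty]
      simp
  have hsub : ∀ (A s : Finset ℕ) (a : ℕ → ℝ), A ⊆ s →
      ‖∑ k ∈ A, a k • w k‖ ≤ K * ‖∑ k ∈ s, a k • w k‖ := fun A s a hAs ↦ by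
    rw [hproj A s a hAs]
    exact ((b.proj _).le_opNorm _).trans (mul_le_mul_of_nonneg_right (hK _) (norm_nonneg _))
  have hwδ : ∀ k, δ / 2 ≤ ‖w k‖ := fun k ↦ by
    have h1 := hxF k
    have h2 : δ / (4 * K) * (1 / 2 : ℝ) ^ (k + 1) ≤ δ / (4 * K) := by
      simpa using hη {k}
    have h3 : δ / (4 * K) ≤ δ / 4 :=
      div_le_div_of_nonneg_left hδ.le (by norm_num) (by linarith)
    have h4 := norm_sub_norm_le (x (φ k)) (b.proj (F k) (x (φ k)))
    have h5 := hxδ (φ k)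
    have h6 : w k = b.proj (F k) (x (φ k)) := rfl
    rw [h6]
    linarith
  -- Each coefficient is at most `2 * K / δ` times the norm `W` of the block sum, and the errors sum
  -- to at most `δ / (4 * K)`, so the perturbation costs at most half of `W`.
  have hdiff : ∀ (s : Finset ℕ) (a : ℕ → ℝ),
      ‖∑ k ∈ s, a k • y k - ∑ k ∈ s, a k • w k‖ ≤ 1 / 2 * ‖∑ k ∈ s, a k • w k‖ := fun s a ↦ by
    set W := ‖∑ k ∈ s, a k • w k‖ with hW
    have hW0 : 0 ≤ W := norm_nonneg _
    have ha : ∀ k ∈ s, |a k| ≤ 2 * K / δ * W := fun k hk ↦ by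
      have h1 := hsub {k} s a (Finset.singleton_subset_iff.2 hk)
      rw [Finset.sum_singleton, norm_smul, Real.norm_eq_abs] at h1
      have h2 := mul_le_mul_of_nonneg_left (hwδ k) (abs_nonneg (a k))
      rw [div_mul_eq_mul_div, le_div_iff₀ hδ]
      linarith
    rw [← Finset.sum_sub_distrib]
    calc ‖∑ k ∈ s, (a k • y k - a k • w k)‖ ≤ ∑ k ∈ s, ‖a k • y k - a k • w k‖ := norm_sum_le _ _
      _ ≤ ∑ k ∈ s, 2 * K / δ * W * (δ / (4 * K) * (1 / 2) ^ (k + 1)) := by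
          refine Finset.sum_le_sum fun k hk ↦ ?_
          rw [← smul_sub, norm_smul, Real.norm_eq_abs]
          exact mul_le_mul (ha k hk) (hxF k) (norm_nonneg _) (by positivity)
      _ ≤ 2 * K / δ * W * (δ / (4 * K)) := by
          rw [← Finset.mul_sum]
          exact mul_le_mul_of_nonneg_left (hη s) (by positivity)
      _ = 1 / 2 * W := by field_simp; ring
  intro s a ε
  have hconv : ∀ z : ℕ → X, ∑ n ∈ s, ε n • a n • z n = ∑ n ∈ s, (((ε n : ℤ) : ℝ) * a n) • z n :=
    fun z ↦ Finset.sum_congr rfl fun n _ ↦ by rw [units_int_smul_eq, smul_smul]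
  have hWε : ‖∑ n ∈ s, (((ε n : ℤ) : ℝ) * a n) • w n‖ ≤ 2 * K * ‖∑ n ∈ s, a n • w n‖ := by
    rw [← Finset.sum_filter_add_sum_filter_not s (fun n ↦ ε n = 1)]
    refine (norm_add_le _ _).trans ?_
    have e1 : ∑ n ∈ s with ε n = 1, (((ε n : ℤ) : ℝ) * a n) • w n =
        ∑ n ∈ s with ε n = 1, a n • w n :=
      Finset.sum_congr rfl fun n hn ↦ by simp [(Finset.mem_filter.1 hn).2]
    have e2 : ∑ n ∈ s with ¬ ε n = 1, (((ε n : ℤ) : ℝ) * a n) • w n =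
        -∑ n ∈ s with ¬ ε n = 1, a n • w n := by
      rw [← Finset.sum_neg_distrib]
      refine Finset.sum_congr rfl fun n hn ↦ ?_
      rw [(Int.units_eq_one_or (ε n)).resolve_left (Finset.mem_filter.1 hn).2]
      simp
    rw [e1, e2, norm_neg]
    linarith [hsub _ s a (Finset.filter_subset (fun n ↦ ε n = 1) s),
      hsub _ s a (Finset.filter_subset (fun n ↦ ¬ ε n = 1) s)]
  rw [hconv]
  have h1 := hdiff s a
  have h2 := hdiff s fun n ↦ ((ε n : ℤ) : ℝ) * a n
  have h3 := norm_sub_norm_le (∑ n ∈ s, (((ε n : ℤ) : ℝ) * a n) • y n)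
    (∑ n ∈ s, (((ε n : ℤ) : ℝ) * a n) • w n)
  have h4 := norm_sub_norm_le (∑ n ∈ s, a n • w n) (∑ n ∈ s, a n • y n)
  rw [norm_sub_rev] at h4
  have h5 : ‖∑ n ∈ s, a n • w n‖ ≤ 2 * ‖∑ n ∈ s, a n • y n‖ := by linarith
  have h6 := mul_le_mul_of_nonneg_left h5 (show 0 ≤ 3 * K by positivity)
  linarith

end Unconditional

/-! ### Un-null and almost order bounded sequences; Kadec–Pełczyński disjointification. -/

section UnboundedConvergence

open Filter Topology

variable {E : Type*} [NormedAddCommGroup E] [NormedSpace ℝ E]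
    [Lattice E] [IsOrderedAddMonoid E] [IsOrderedModule ℝ E] [HasSolidNorm E]

/-- `u` is a quasi-interior point: truncations at multiples of `u` approximate every element. -/
def IsQuasiInterior (u : E) : Prop :=
  0 ≤ u ∧ ∀ (x : E) (ε : ℝ), 0 < ε → ∃ M : ℝ, 0 ≤ M ∧ ‖(|x| - M • u)⁺‖ ≤ ε

/-- The sequence `x` converges to zero in the unbounded norm sense, tested on `u`. -/
def IsUnNull (u : E) (x : ℕ → E) : Prop := Tendsto (fun n ↦ ‖|x n| ⊓ u‖) atTop (𝓝 0)

/-- The sequence `x` is eventually contained, up to small errors in norm, in multiples of the order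
interval `[-u, u]`. -/
def IsAlmostOrderBounded (u : E) (x : ℕ → E) : Prop :=
  ∀ ε : ℝ, 0 < ε → ∃ M : ℝ, 0 ≤ M ∧ ∀ᶠ n in atTop, ‖(|x n| - M • u)⁺‖ ≤ ε

omit [HasSolidNorm E] in
theorem inf_smul_le_smul_inf {y u : E} (hy : 0 ≤ y) (hu : 0 ≤ u) (M : ℝ) :
    y ⊓ M • u ≤ (|M| + 1) • (y ⊓ u) := by
  rw [smul_inf_of_nonneg (by positivity)]
  refine inf_le_inf ?_ (smul_le_smul_of_nonneg_right (by linarith [le_abs_self M]) hu)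
  calc y = (1 : ℝ) • y := (one_smul ℝ y).symm
    _ ≤ _ := smul_le_smul_of_nonneg_right (by linarith [abs_nonneg M]) hy

omit [NormedSpace ℝ E] [IsOrderedModule ℝ E] in
theorem norm_posPart_sub_le_add (x y w : E) :
    ‖(|x| - w)⁺‖ ≤ ‖(|y| - w)⁺‖ + ‖x - y‖ := by
  rw [← norm_abs_eq_norm (x - y)]
  refine (norm_le_norm_of_nonneg_of_le (posPart_nonneg _) ?_).trans (norm_add_le _ _)
  rw [posPart_def]
  refine sup_le ?_ (add_nonneg (posPart_nonneg _) (abs_nonneg _))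
  have h1 : |x| ≤ |y| + |x - y| := by simpa using abs_add_le y (x - y)
  calc |x| - w ≤ (|y| + |x - y|) - w := sub_le_sub_right h1 w
    _ = (|y| - w) + |x - y| := by abel
    _ ≤ _ := add_le_add_left (le_posPart _) _

omit [NormedSpace ℝ E] [IsOrderedModule ℝ E] in
theorem norm_abs_inf_le_add {u : E} (hu : 0 ≤ u) (x y : E) :
    ‖|x + y| ⊓ u‖ ≤ ‖|x| ⊓ u‖ + ‖|y| ⊓ u‖ := by
  refine (norm_le_norm_of_nonneg_of_le (le_inf (abs_nonneg _) hu) ?_).trans (norm_add_le _ _)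
  exact (inf_le_inf_right u (abs_add_le x y)).trans
    (add_inf_le_inf_add_inf (abs_nonneg _) (abs_nonneg _) hu)

omit [NormedSpace ℝ E] [IsOrderedModule ℝ E] in
theorem norm_abs_inf_le {u : E} (hu : 0 ≤ u) (x : E) : ‖|x| ⊓ u‖ ≤ ‖x‖ := by
  rw [← norm_abs_eq_norm x]
  exact norm_le_norm_of_nonneg_of_le (le_inf (abs_nonneg _) hu) inf_le_left

omit [NormedSpace ℝ E] [IsOrderedAddMonoid E] [IsOrderedModule ℝ E] [HasSolidNorm E] in
theorem IsUnNull.comp {u : E} {x : ℕ → E} (hx : IsUnNull u x) {φ : ℕ → ℕ}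
    (hφ : Tendsto φ atTop atTop) : IsUnNull u (x ∘ φ) :=
  Tendsto.comp (g := fun n ↦ ‖|x n| ⊓ u‖) hx hφ

omit [IsOrderedAddMonoid E] [IsOrderedModule ℝ E] [HasSolidNorm E] in
theorem IsAlmostOrderBounded.comp {u : E} {x : ℕ → E} (hx : IsAlmostOrderBounded u x) {φ : ℕ → ℕ}
    (hφ : Tendsto φ atTop atTop) : IsAlmostOrderBounded u (x ∘ φ) := fun ε hε ↦ by
  obtain ⟨M, hM, h⟩ := hx ε hε
  exact ⟨M, hM, hφ.eventually h⟩

/-- Split `|x n|` as `|x n| ⊓ M • u` plus the excess over `M • u`: the first is controlled by `|x n|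
⊓ u`, the second by almost order boundedness. -/
theorem IsUnNull.tendsto_zero {u : E} (hu : 0 ≤ u) {x : ℕ → E} (hx : IsUnNull u x)
    (hx' : IsAlmostOrderBounded u x) : Tendsto x atTop (𝓝 0) := by
  rw [tendsto_zero_iff_norm_tendsto_zero, Metric.tendsto_nhds]
  intro ε hε
  obtain ⟨M, hM, h⟩ := hx' (ε / 2) (half_pos hε)
  have h1 : Tendsto (fun n ↦ (|M| + 1) * ‖|x n| ⊓ u‖) atTop (𝓝 0) := by
    simpa using Tendsto.const_mul (|M| + 1) hx
  filter_upwards [h, h1.eventually_lt_const (half_pos hε)] with n h2 h3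
  rw [dist_zero_right, norm_norm, ← norm_abs_eq_norm, ← inf_add_posPart_sub |x n| (M • u)]
  refine (norm_add_le _ _).trans_lt ?_
  have h4 := norm_le_norm_of_nonneg_of_le (le_inf (abs_nonneg (x n)) (smul_nonneg hM hu))
    (inf_smul_le_smul_inf (abs_nonneg (x n)) hu M)
  rw [norm_smul, Real.norm_of_nonneg (by positivity)] at h4
  linarith

theorem IsUnNull.tendsto_norm_inf {u : E} (hu : IsQuasiInterior u) {y : ℕ → E} (hy0 : ∀ n, 0 ≤ y n)
    (hy : IsUnNull u y) {z : E} (hz : 0 ≤ z) : Tendsto (fun n ↦ ‖y n ⊓ z‖) atTop (𝓝 0) := by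
  rw [Metric.tendsto_nhds]
  intro ε hε
  obtain ⟨M, hM, h⟩ := hu.2 z (ε / 2) (half_pos hε)
  rw [abs_of_nonneg hz] at h
  have h1 : Tendsto (fun n ↦ (|M| + 1) * ‖|y n| ⊓ u‖) atTop (𝓝 0) := by
    simpa using Tendsto.const_mul (|M| + 1) hy
  filter_upwards [h1.eventually_lt_const (half_pos hε)] with n h3
  rw [dist_zero_right, norm_norm]
  rw [abs_of_nonneg (hy0 n)] at h3
  have hMu := smul_nonneg hM hu.1
  have h2 : y n ⊓ z ≤ (|M| + 1) • (y n ⊓ u) + (z - M • u)⁺ := by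
    calc y n ⊓ z ≤ (M • u + (z - M • u)⁺) ⊓ y n := by
          rw [inf_comm]
          exact inf_le_inf_right _ (sub_le_iff_le_add'.1 (le_posPart _))
      _ ≤ (M • u) ⊓ y n + (z - M • u)⁺ ⊓ y n :=
          add_inf_le_inf_add_inf hMu (posPart_nonneg _) (hy0 n)
      _ ≤ _ := add_le_add (by rw [inf_comm]; exact inf_smul_le_smul_inf (hy0 n) hu.1 M) inf_le_left
  have h4 := (norm_le_norm_of_nonneg_of_le (le_inf (hy0 n) hz) h2).trans (norm_add_le _ _)
  rw [norm_smul, Real.norm_of_nonneg (by positivity)] at h4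
  linarith

-- When `s * t = 1`, the two elements are nonnegative multiples of the positive and the negative
-- part of the same vector `x - s • y`.
omit [HasSolidNorm E] in
theorem posPart_sub_inf_posPart_sub_eq_zero {x y : E} {s t : ℝ} (hs : 0 ≤ s) (hst : s * t = 1) :
    (x - s • y)⁺ ⊓ (y - t • x)⁺ = 0 := by
  have ht : 0 ≤ t := by
    by_contra! h
    linarith [mul_nonpos_of_nonneg_of_nonpos hs h.le]
  have h1 : y - t • x = t • (-(x - s • y)) := by
    rw [neg_sub, smul_sub, smul_smul, mul_comm, hst, one_smul]
  have h2 : (y - t • x)⁺ = t • (x - s • y)⁻ := by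
    rw [h1, posPart_def, negPart_def, smul_sup_of_nonneg ht, smul_zero]
  rw [h2]
  simpa using smul_inf_smul_eq_zero (posPart_nonneg (x - s • y)) (negPart_nonneg _)
    (posPart_inf_negPart_eq_zero _) zero_le_one ht

/-- Kadec–Pełczyński disjointification for positive sequences. -/
theorem IsUnNull.exists_disjoint_subseq_of_nonneg [CompleteSpace E] {u : E} (hu : IsQuasiInterior u)
    {y : ℕ → E} (hy0 : ∀ n, 0 ≤ y n) (hy : IsUnNull u y) {B : ℝ} (hB : ∀ n, ‖y n‖ ≤ B) :
    ∃ (φ : ℕ → ℕ) (D : ℕ → E), StrictMono φ ∧ (∀ k, 0 ≤ D k ∧ D k ≤ y (φ k)) ∧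
      (∀ j k, j ≠ k → D j ⊓ D k = 0) ∧ Tendsto (fun k ↦ ‖y (φ k) - D k‖) atTop (𝓝 0) := by
  -- Used with `z` the sum of the terms already chosen: the next term is nearly disjoint even from
  -- `2 ^ k` times that sum.
  have step : ∀ (k N : ℕ) (z : E), ∃ n, N < n ∧ ‖y n ⊓ (2 : ℝ) ^ k • |z|‖ ≤ (1 / 2 : ℝ) ^ k :=
    fun k N z ↦ by
      have h1 := hy.tendsto_norm_inf hu hy0 (z := (2 : ℝ) ^ k • |z|)
        (smul_nonneg (by positivity) (abs_nonneg z))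
      obtain ⟨n, hn, hn'⟩ := ((h1.eventually_lt_const (show (0 : ℝ) < (1 / 2) ^ k by positivity)).and
        (eventually_gt_atTop N)).exists
      exact ⟨n, hn', hn.le⟩
  choose f hf hfy using step
  let st : ℕ → ℕ × E := fun k ↦
    Nat.rec (0, 0) (fun k s ↦ (f k s.1 s.2, s.2 + y (f k s.1 s.2))) k
  set φ : ℕ → ℕ := fun k ↦ f k (st k).1 (st k).2 with hφ
  have hst : ∀ k, st (k + 1) = (φ k, (st k).2 + y (φ k)) := fun k ↦ rfl
  have hst2 : ∀ k, (st k).2 = ∑ i ∈ Finset.range k, y (φ i) := fun k ↦ by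
    induction k with
    | zero => rfl
    | succ k ih => rw [hst, Finset.sum_range_succ, ih]
  have hst0 : ∀ k, 0 ≤ (st k).2 := fun k ↦ by
    rw [hst2]; exact Finset.sum_nonneg fun i _ ↦ hy0 _
  have hφm : StrictMono φ := strictMono_nat_of_lt_succ fun k ↦ by
    have := hf (k + 1) (st (k + 1)).1 (st (k + 1)).2
    rwa [show (st (k + 1)).1 = φ k from rfl] at this
  have hB0 : 0 ≤ B := (norm_nonneg _).trans (hB 0)
  have hgeom : HasSum (fun i : ℕ ↦ B * (1 / 2 : ℝ) ^ i) (B * 2) := hasSum_geometric_two.mul_left B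
  have hterm : ∀ k i : ℕ, ‖(1 / 2 : ℝ) ^ (i + k + 1) • y (φ (i + k + 1))‖ ≤
      (1 / 2) ^ (k + 1) * (B * (1 / 2) ^ i) := fun k i ↦ by
    rw [norm_smul, Real.norm_of_nonneg (by positivity)]
    calc (1 / 2 : ℝ) ^ (i + k + 1) * ‖y (φ (i + k + 1))‖ ≤ (1 / 2 : ℝ) ^ (i + k + 1) * B := by
          gcongr; exact hB _
      _ = _ := by ring
  have hsummable : ∀ k : ℕ, Summable fun i : ℕ ↦ (1 / 2 : ℝ) ^ (i + k + 1) • y (φ (i + k + 1)) :=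
    fun k ↦ Summable.of_norm_bounded (hgeom.summable.mul_left _) (hterm k)
  set t : ℕ → E := fun k ↦ ∑' i : ℕ, (1 / 2 : ℝ) ^ (i + k + 1) • y (φ (i + k + 1)) with ht
  have hpos : ∀ k i : ℕ, 0 ≤ (1 / 2 : ℝ) ^ (i + k + 1) • y (φ (i + k + 1)) := fun k i ↦
    smul_nonneg (by positivity) (hy0 _)
  have ht0 : ∀ k, 0 ≤ t k := fun k ↦ tsum_nonneg (hpos k)
  have htn : ∀ k, ‖t k‖ ≤ B * (1 / 2) ^ k := fun k ↦ by
    refine (tsum_of_norm_bounded (hgeom.mul_left _) (hterm k)).trans (le_of_eq ?_)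
    ring
  have htj : ∀ j k, j < k → (1 / 2 : ℝ) ^ k • y (φ k) ≤ t j := fun j k hjk ↦ by
    obtain ⟨i, rfl⟩ := Nat.exists_eq_add_of_lt hjk
    rw [Nat.add_comm j i]
    exact (hsummable j).le_tsum i fun l _ ↦ hpos j l
  have hsj : ∀ j k, j < k → y (φ j) ≤ (st k).2 := fun j k hjk ↦ by
    rw [hst2]
    exact Finset.single_le_sum (f := fun i ↦ y (φ i)) (fun i _ ↦ hy0 _) (Finset.mem_range.2 hjk)
  -- Subtract `2 ^ k` times the earlier terms and a `2⁻ⁱ`-weighted sum of the later ones. For `j <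
  -- k` this puts `D k` below `(y_k - 2 ^ k • y_j)⁺` and `D j` below `(y_j - 2⁻ᵏ • y_k)⁺`, which are
  -- disjoint.
  set D : ℕ → E := fun k ↦ (y (φ k) - ((2 : ℝ) ^ k • (st k).2 + t k))⁺ with hD
  have ha0 : ∀ k, 0 ≤ (2 : ℝ) ^ k • (st k).2 := fun k ↦ smul_nonneg (by positivity) (hst0 k)
  have hD0 : ∀ k, 0 ≤ D k := fun k ↦ posPart_nonneg _
  have hDy : ∀ k, D k ≤ y (φ k) := fun k ↦ by
    exact sup_le (sub_le_self _ (add_nonneg (ha0 k) (ht0 k))) (hy0 _)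
  have hlt : ∀ j k, j < k → D j ⊓ D k = 0 := fun j k hjk ↦ by
    refine le_antisymm ?_ (le_inf (hD0 j) (hD0 k))
    rw [inf_comm, ← posPart_sub_inf_posPart_sub_eq_zero (x := y (φ k)) (y := y (φ j))
      (s := 2 ^ k) (t := (1 / 2) ^ k) (by positivity) (by rw [← mul_pow]; norm_num)]
    refine inf_le_inf (posPart_mono (sub_le_sub_left ?_ _)) (posPart_mono (sub_le_sub_left ?_ _))
    · exact (smul_le_smul_of_nonneg_left (hsj j k hjk) (by positivity)).trans
        (le_add_of_nonneg_right (ht0 k))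
    · exact (htj j k hjk).trans (le_add_of_nonneg_left (ha0 j))
  refine ⟨φ, D, hφm, fun k ↦ ⟨hD0 k, hDy k⟩, fun j k hjk ↦ ?_, ?_⟩
  · rcases lt_or_gt_of_ne hjk with h | h
    · exact hlt j k h
    · rw [inf_comm]; exact hlt k j h
  · have hbound : ∀ k, ‖y (φ k) - D k‖ ≤ (1 + B) * (1 / 2 : ℝ) ^ k := fun k ↦ by
      have h1 : y (φ k) - D k ≤ y (φ k) ⊓ (2 : ℝ) ^ k • |(st k).2| + t k := by
        rw [abs_of_nonneg (hst0 k)]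
        calc y (φ k) - D k = ((2 : ℝ) ^ k • (st k).2 + t k) ⊓ y (φ k) := by
              rw [sub_eq_iff_eq_add, inf_comm, hD, inf_add_posPart_sub]
          _ ≤ _ := add_inf_le_inf_add_inf (ha0 k) (ht0 k) (hy0 _)
          _ ≤ _ := add_le_add (by rw [inf_comm]) inf_le_left
      have h2 := (norm_le_norm_of_nonneg_of_le (sub_nonneg.2 (hDy k)) h1).trans (norm_add_le _ _)
      have h3 := hfy k (st k).1 (st k).2
      have h4 := htn k
      have h5 : f k (st k).1 (st k).2 = φ k := rfl
      rw [h5] at h3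
      linarith
    refine squeeze_zero (fun k ↦ norm_nonneg _) hbound ?_
    simpa using (tendsto_pow_atTop_nhds_zero_of_lt_one (by norm_num : (0 : ℝ) ≤ 1 / 2)
      (by norm_num)).const_mul (1 + B)

/-- Kadec–Pełczyński disjointification. -/
theorem IsUnNull.exists_disjoint_subseq [CompleteSpace E] {u : E} (hu : IsQuasiInterior u)
    {x : ℕ → E} (hx : IsUnNull u x) {B : ℝ} (hB : ∀ n, ‖x n‖ ≤ B) :
    ∃ (φ : ℕ → ℕ) (d : ℕ → E), StrictMono φ ∧ (∀ k, ‖d k‖ ≤ B) ∧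
      (∀ j k, j ≠ k → |d j| ⊓ |d k| = 0) ∧ Tendsto (fun k ↦ x (φ k) - d k) atTop (𝓝 0) := by
  obtain ⟨φ, D, hφ, hD, hDD, hlim⟩ := IsUnNull.exists_disjoint_subseq_of_nonneg hu
    (y := fun n ↦ |x n|) (fun n ↦ abs_nonneg _) (by simpa only [IsUnNull, abs_abs] using hx)
    (B := B) (fun n ↦ by rw [norm_abs_eq_norm]; exact hB n)
  have hd : ∀ k, |latticeTrunc (D k) (x (φ k))| ≤ D k := fun k ↦ abs_latticeTrunc_le (hD k).1 _
  refine ⟨φ, fun k ↦ latticeTrunc (D k) (x (φ k)), hφ, fun k ↦ ?_, fun j k hjk ↦ ?_, ?_⟩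
  · refine le_trans ?_ (hB (φ k))
    rw [← norm_abs_eq_norm (x (φ k))]
    exact norm_le_norm_of_abs_le ((hd k).trans (hD k).2)
  · refine le_antisymm ?_ (le_inf (abs_nonneg _) (abs_nonneg _))
    rw [← hDD j k hjk]
    exact inf_le_inf (hd j) (hd k)
  · rw [tendsto_zero_iff_norm_tendsto_zero]
    refine squeeze_zero (fun k ↦ norm_nonneg _) (fun k ↦ norm_le_norm_of_abs_le ?_) hlim
    refine (abs_sub_latticeTrunc_le _ _).trans (le_of_eq ?_)
    exact posPart_eq_self.2 (sub_nonneg.2 (hD k).2)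

end UnboundedConvergence

/-! ### Strictly singular operators on order bounded and on un-null sequences. -/

section StrictlySingular

open Filter Topology

variable {E : Type*} [NormedAddCommGroup E] [NormedSpace ℝ E]

theorem IsStrictlySingular.false_of_norm_sum_le {Y : Type*} [NormedAddCommGroup Y] [NormedSpace ℝ Y]
    {S : E →L[ℝ] Y} (hS : IsStrictlySingular S) (x : ℕ → E)
    (hind : ∀ (n : ℕ) (a : Fin n → ℝ), ∑ i, a i • x i = 0 → a = 0) {D : ℝ} (hD0 : 0 < D)
    (hD : ∀ (n : ℕ) (a : Fin n → ℝ), ‖∑ i, a i • x i‖ ≤ D * ‖S (∑ i, a i • x i)‖) : False := by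
  classical
  have hli : LinearIndependent ℝ x := by
    rw [linearIndependent_iff']
    intro s g hg i hi
    obtain ⟨n, hn⟩ := s.exists_nat_subset_range
    have h1 := hind n (fun i ↦ if (i : ℕ) ∈ s then g i else 0) (by
      rw [← hg, Fin.sum_univ_eq_sum_range (fun i ↦ (if i ∈ s then g i else 0) • x i) n]
      simp only [ite_smul, zero_smul]
      rw [← Finset.sum_filter, Finset.filter_mem_eq_inter, Finset.inter_eq_right.2 hn])
    have h2 := congrFun h1 ⟨i, Finset.mem_range.1 (hn hi)⟩
    simpa [hi] using h2
  refine hS (Submodule.span ℝ (Set.range x)) (fun hfin ↦ ?_) ⟨D⁻¹, inv_pos.2 hD0, fun v hv ↦ ?_⟩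
  · exact not_finite_iff_infinite.2 (inferInstanceAs (Infinite ℕ)) (linearIndependent_span hli).finite
  · obtain ⟨c, rfl⟩ := (Finsupp.mem_span_range_iff_exists_finsupp).1 hv
    obtain ⟨n, hn⟩ := c.support.exists_nat_subset_range
    have h1 := hD n fun i ↦ c i
    have h2 : (c.sum fun i a ↦ a • x i) = ∑ i : Fin n, c i • x i := by
      rw [Finsupp.sum_of_support_subset c hn _ fun i _ ↦ zero_smul ℝ (x i), Finset.sum_range]
    rw [h2, inv_mul_le_iff₀ hD0]
    exact h1

variable [Lattice E] [IsOrderedAddMonoid E] [IsOrderedModule ℝ E] [HasSolidNorm E]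

/-- All coordinates of the sequence `x` tend to zero. -/
def IsCoordNull {ι : Type*} (b : UnconditionalSchauderBasis ι ℝ E) (x : ℕ → E) : Prop :=
  ∀ i, Tendsto (fun n ↦ b.coord i (x n)) atTop (𝓝 0)

omit [Lattice E] [IsOrderedAddMonoid E] [IsOrderedModule ℝ E] [HasSolidNorm E] in
theorem IsCoordNull.comp {ι : Type*} {b : UnconditionalSchauderBasis ι ℝ E} {x : ℕ → E}
    (hx : IsCoordNull b x) {φ : ℕ → ℕ} (hφ : Tendsto φ atTop atTop) : IsCoordNull b (x ∘ φ) :=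
  fun i ↦ (hx i).comp hφ

variable [CompleteSpace E] {ι : Type*} (b : UnconditionalSchauderBasis ι ℝ E)

/-- A strictly singular operator maps order bounded sequences to unbounded-norm null ones. -/
theorem IsStrictlySingular.isUnNull_of_abs_le (hcot : HasFiniteCotype E) {S : E →L[ℝ] E}
    (hS : IsStrictlySingular S) {u : E} (hu : 0 ≤ u) {w : E} (hw : 0 ≤ w) {e : ℕ → E}
    (hew : ∀ n, |e n| ≤ w) (he : IsCoordNull b e) (hSe : IsCoordNull b (S ∘ e)) :
    IsUnNull u (S ∘ e) := by
  obtain ⟨q, hq2, hq⟩ := hcot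
  obtain ⟨M, hM0, hM⟩ := hq.exists_nonneg
  have hq1 : 1 ≤ q := by linarith
  by_contra hnot
  obtain ⟨δ, hδ, hfreq⟩ : ∃ δ : ℝ, 0 < δ ∧ ∃ᶠ n in atTop, δ ≤ ‖|S (e n)| ⊓ u‖ := by
    rw [IsUnNull, Metric.tendsto_nhds] at hnot
    push Not at hnot
    obtain ⟨δ, hδ, h⟩ := hnot
    refine ⟨δ, hδ, h.mono fun n hn ↦ ?_⟩
    simpa using hn
  obtain ⟨φ₀, hφ₀, hδ₀⟩ := extraction_of_frequently_atTop hfreq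
  have hSδ : ∀ n, δ ≤ ‖S (e (φ₀ n))‖ := fun n ↦ (hδ₀ n).trans (norm_abs_inf_le hu _)
  have heδ : ∀ n, δ / (‖S‖ + 1) ≤ ‖e (φ₀ n)‖ := fun n ↦ by
    rw [div_le_iff₀ (by positivity)]
    have h1 := S.le_opNorm (e (φ₀ n))
    nlinarith [hSδ n, norm_nonneg (e (φ₀ n))]
  -- Both the images and the vectors stay away from zero, so a common subsequence is unconditional
  -- on both sides, and sign averages are comparable with norms.
  obtain ⟨φ₁, hφ₁, K₁, hK₁, hunc₁⟩ := b.exists_unconditional_subseq (S ∘ e ∘ φ₀)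
    (hSe.comp hφ₀.tendsto_atTop) hδ hSδ
  obtain ⟨φ₂, hφ₂, K₂, hK₂, hunc₂⟩ := b.exists_unconditional_subseq (e ∘ φ₀ ∘ φ₁)
    (he.comp (hφ₀.comp hφ₁).tendsto_atTop) (δ := δ / (‖S‖ + 1)) (by positivity)
    fun n ↦ heδ (φ₁ n)
  set x : ℕ → E := e ∘ φ₀ ∘ φ₁ ∘ φ₂ with hx
  have hux : IsSignUnconditionalWith K₂ x := hunc₂
  have huS : IsSignUnconditionalWith K₁ (S ∘ x) := hunc₁.comp hφ₂
  obtain ⟨φ, hφ, c, hc, hφc⟩ := hM.exists_positive_functional hM0 hq1 hu hδ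
    (fun n ↦ |S (x n)| ⊓ u) (fun n ↦ ⟨le_inf (abs_nonneg _) hu, inf_le_right⟩)
    (fun n ↦ hδ₀ (φ₁ (φ₂ n)))
  have hφc' : ∀ n, c ≤ φ |S (x n)| := fun n ↦ by
    have h1 := hφ _ (sub_nonneg.2 (inf_le_left : |S (x n)| ⊓ u ≤ _))
    rw [map_sub] at h1
    linarith [hφc n]
  obtain ⟨C, hC0, hC⟩ := hM.exists_signAvg_norm_le hM0 hq1 hw
  -- Lower `ℓ²` estimate for the images; with the upper `ℓ²` estimate `hup` for the vectors it
  -- bounds `S` below on their span.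
  have hlow : ∀ (n : ℕ) (a : Fin n → ℝ), c * √(∑ i, a i ^ 2) ≤
      Real.exp 1 * ‖φ‖ * K₁ * ‖S (∑ i, a i • x i)‖ := fun n a ↦ by
    refine (sqrt_sum_sq_le_signAvg_norm φ hφ hc (fun i : Fin n ↦ S (x i)) (fun i ↦ hφc' i) a).trans ?_
    rw [mul_assoc _ K₁]
    refine mul_le_mul_of_nonneg_left ?_ (by positivity)
    have h1 := huS.signAvg_le a
    simpa only [map_sum, map_smul, Function.comp_apply] using h1
  have hup : ∀ (n : ℕ) (a : Fin n → ℝ), ‖∑ i, a i • x i‖ ≤ K₂ * (C * √(∑ i, a i ^ 2)) :=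
    fun n a ↦ (hux.le_signAvg a).trans
      (mul_le_mul_of_nonneg_left (hC n _ (fun i ↦ hew _) a) hK₂.le)
  refine hS.false_of_norm_sum_le x (fun n a ha ↦ ?_)
    (D := K₂ * C * (Real.exp 1 * ‖φ‖ * K₁) / c + 1) (by positivity) fun n a ↦ ?_
  · have h1 := hlow n a
    rw [ha, map_zero, norm_zero, mul_zero] at h1
    have h2 : √(∑ i, a i ^ 2) = 0 :=
      le_antisymm (by by_contra! h; linarith [mul_pos hc h]) (Real.sqrt_nonneg _)
    have hs : 0 ≤ ∑ i, a i ^ 2 := Finset.sum_nonneg fun i _ ↦ sq_nonneg _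
    rw [Real.sqrt_eq_zero hs, Finset.sum_eq_zero_iff_of_nonneg fun i _ ↦ sq_nonneg _] at h2
    funext i
    simpa using h2 i (Finset.mem_univ i)
  · have h1 := hlow n a
    set R := ‖S (∑ i, a i • x i)‖
    have hR : 0 ≤ R := norm_nonneg _
    calc ‖∑ i, a i • x i‖ ≤ K₂ * (C * √(∑ i, a i ^ 2)) := hup n a
      _ = K₂ * C / c * (c * √(∑ i, a i ^ 2)) := by field_simp
      _ ≤ K₂ * C / c * (Real.exp 1 * ‖φ‖ * K₁ * R) := by gcongr
      _ = K₂ * C * (Real.exp 1 * ‖φ‖ * K₁) / c * R := by ring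
      _ ≤ _ := by rw [add_mul]; linarith

-- Khinchine with `b` concentrated at one index puts each `|aᵢ| • |yᵢ|` below `√2` times the average
-- of `|∑ εᵢ aᵢ yᵢ|`. Disjoint elements below a common bound have their sum below it.
omit [CompleteSpace E] in
theorem norm_sum_disjoint_le_signAvg {n : ℕ} (D y : Fin n → E) (hD : ∀ i, 0 ≤ D i ∧ D i ≤ |y i|)
    (hDD : ∀ i j, i ≠ j → D i ⊓ D j = 0) (a : Fin n → ℝ) :
    ‖∑ i, a i • D i‖ ≤ √2 * signAvg fun ε ↦ ‖∑ i, ε i • a i • y i‖ := by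
  classical
  set Z : E := (√2 / 2 ^ n) • ∑ ε : Fin n → ℤˣ, |∑ i, ε i • a i • y i| with hZ
  have hZ0 : 0 ≤ Z := smul_nonneg (by positivity) (Finset.sum_nonneg fun ε _ ↦ abs_nonneg _)
  have h1 : ∀ i, |a i| • D i ≤ Z := fun i ↦ by
    have h2 := sum_abs_smul_le_sum_abs_signs (Pi.single i (1 : ℝ)) fun j ↦ a j • y j
    have h3 : ∏ j, √(1 + (Pi.single i (1 : ℝ) : Fin n → ℝ) j ^ 2) = √2 := by
      rw [Finset.prod_eq_single i (fun j _ hj ↦ by simp [Pi.single_eq_of_ne hj]) (by simp)]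
      norm_num
    rw [h3] at h2
    have h4 := (Finset.single_le_sum (fun j _ ↦ abs_nonneg _) (Finset.mem_univ i)).trans h2
    simp only [Pi.single_eq_same, mul_one] at h4
    rw [lattice_abs_smul, abs_of_pos (by positivity : (0 : ℝ) < 2 ^ n), lattice_abs_smul] at h4
    calc |a i| • D i ≤ |a i| • |y i| := smul_le_smul_of_nonneg_left (hD i).2 (abs_nonneg _)
      _ = ((2 : ℝ) ^ n)⁻¹ • (2 : ℝ) ^ n • |a i| • |y i| := by
          rw [inv_smul_smul₀ (by positivity)]
      _ ≤ ((2 : ℝ) ^ n)⁻¹ • √2 • ∑ ε : Fin n → ℤˣ, |∑ i, ε i • a i • y i| :=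
          smul_le_smul_of_nonneg_left h4 (by positivity)
      _ = Z := by rw [hZ, smul_smul]; congr 1; ring
  have h2 : |∑ i, a i • D i| ≤ Z := by
    refine (lattice_abs_sum_le _ _).trans ?_
    rw [Finset.sum_congr rfl fun i _ ↦ by rw [lattice_abs_smul, abs_of_nonneg (hD i).1]]
    exact sum_le_of_pairwise_disjoint _ _ hZ0 (fun i _ ↦ smul_nonneg (abs_nonneg _) (hD i).1)
      (fun i _ j _ hij ↦ smul_inf_smul_eq_zero (hD i).1 (hD j).1 (hDD i j hij) (abs_nonneg _)
        (abs_nonneg _)) fun i _ ↦ h1 i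
  refine (norm_le_norm_of_abs_le h2).trans ?_
  rw [hZ, norm_smul, Real.norm_of_nonneg (by positivity), signAvg, div_mul_eq_mul_div,
    mul_div_assoc]
  gcongr
  refine (norm_sum_le _ _).trans (Finset.sum_le_sum fun ε _ ↦ ?_)
  rw [norm_abs_eq_norm]

omit [CompleteSpace E] in
theorem norm_sum_le_of_disjoint_of_abs_le {n : ℕ} (D : Fin n → E)
    (hD : ∀ i j, i ≠ j → |D i| ⊓ |D j| = 0) {a a' : Fin n → ℝ} (h : ∀ i, |a i| ≤ |a' i|) :
    ‖∑ i, a i • D i‖ ≤ ‖∑ i, a' i • D i‖ := by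
  refine norm_le_norm_of_abs_le_abs ?_
  rw [abs_sum_of_pairwise_disjoint _ _ fun i _ j _ hij ↦
      abs_smul_inf_abs_smul_eq_zero (hD i j hij) _ _,
    abs_sum_of_pairwise_disjoint _ _ fun i _ j _ hij ↦
      abs_smul_inf_abs_smul_eq_zero (hD i j hij) _ _]
  refine Finset.sum_le_sum fun i _ ↦ ?_
  rw [lattice_abs_smul, lattice_abs_smul]
  exact smul_le_smul_of_nonneg_right (h i) (abs_nonneg _)

omit [CompleteSpace E] [HasSolidNorm E] in
theorem isNormalizedDisjointSeq_normalize {d : ℕ → E} (hd : ∀ j k, j ≠ k → |d j| ⊓ |d k| = 0)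
    (hd0 : ∀ n, d n ≠ 0) : IsNormalizedDisjointSeq fun n ↦ ‖d n‖⁻¹ • d n := by
  refine ⟨fun n ↦ ?_, fun m n hmn ↦ abs_smul_inf_abs_smul_eq_zero (hd m n hmn) _ _⟩
  rw [norm_smul, norm_inv, norm_norm, inv_mul_cancel₀ (norm_ne_zero_iff.2 (hd0 n))]

-- Disjoint homogeneity bounds `∑ aᵢ dᵢ` by the matching combination of `D`; this is dominated by
-- sign averages of `∑ aᵢ S dᵢ`, hence, by unconditionality, by `S (∑ aᵢ dᵢ)`. The factor `B / η`
-- accounts for normalising `d` and `D`.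
omit [CompleteSpace E] in
theorem IsStrictlySingular.false_of_disjoint_minorant (hDH : IsDisjointlyHomogeneous E)
    {S : E →L[ℝ] E} (hS : IsStrictlySingular S) {d D : ℕ → E}
    (hd : ∀ j k, j ≠ k → |d j| ⊓ |d k| = 0) {B : ℝ} (hB : ∀ n, ‖d n‖ ≤ B)
    (hD : ∀ n, 0 ≤ D n ∧ D n ≤ |S (d n)|) (hDD : ∀ j k, j ≠ k → D j ⊓ D k = 0) {η : ℝ}
    (hη : 0 < η) (hDη : ∀ n, η ≤ ‖D n‖) {K : ℝ} (hK : 0 < K)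
    (hunc : IsSignUnconditionalWith K (S ∘ d)) : False := by
  have hD0 : ∀ n, D n ≠ 0 := fun n h ↦ by
    have := hDη n
    rw [h, norm_zero] at this
    linarith
  have hDDabs : ∀ j k, j ≠ k → |D j| ⊓ |D k| = 0 := fun j k hjk ↦ by
    rw [abs_of_nonneg (hD j).1, abs_of_nonneg (hD k).1, hDD j k hjk]
  have hd0 : ∀ n, d n ≠ 0 := fun n h ↦ by
    have := (hD n).2
    rw [h, map_zero, abs_zero] at this
    exact hD0 n (le_antisymm this (hD n).1)
  have hB0 : 0 < B := (norm_pos_iff.2 (hd0 0)).trans_le (hB 0)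
  obtain ⟨C, hC, ρ, hρ, hequiv⟩ := hDH _ _ (isNormalizedDisjointSeq_normalize hd hd0)
    (isNormalizedDisjointSeq_normalize hDDabs hD0)
  have huncρ := hunc.comp hρ
  have hρne : ∀ {i j : ℕ}, i ≠ j → ρ i ≠ ρ j := fun h ↦ hρ.injective.ne h
  refine hS.false_of_norm_sum_le (d ∘ ρ) (fun n a ha ↦ ?_)
    (D := C * (B / η * (√2 * K))) (by positivity) fun n a ↦ ?_
  · funext i
    have h1 := norm_sum_le_of_disjoint_of_abs_le (fun i : Fin n ↦ (d ∘ ρ) i)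
      (fun i j hij ↦ hd _ _ (hρne (Fin.val_ne_of_ne hij))) (a := Pi.single i (a i)) (a' := a)
      (fun j ↦ by
        by_cases h : j = i
        · subst h; simp
        · simp [Pi.single_eq_of_ne h])
    rw [ha, norm_zero, Finset.sum_eq_single i (fun j _ hj ↦ by simp [Pi.single_eq_of_ne hj])
      (by simp), Pi.single_eq_same, norm_smul] at h1
    have h2 := le_antisymm h1 (by positivity)
    simpa [hd0] using h2
  · have h1 := (hequiv (Finset.range n) fun k ↦
      if hk : k < n then a ⟨k, hk⟩ * ‖d (ρ k)‖ else 0).2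
    rw [Finset.sum_range, Finset.sum_range] at h1
    have e1 : ∀ i : Fin n, (if hk : (i : ℕ) < n then a ⟨i, hk⟩ * ‖d (ρ i)‖ else 0) •
        ((fun n ↦ ‖d n‖⁻¹ • d n) ∘ ρ) i = a i • (d ∘ ρ) i := fun i ↦ by
      simp only [Fin.is_lt, dif_pos, Function.comp_apply, smul_smul]
      rw [mul_assoc, mul_inv_cancel₀ (norm_ne_zero_iff.2 (hd0 _)), mul_one]
    have e2 : ∀ i : Fin n, (if hk : (i : ℕ) < n then a ⟨i, hk⟩ * ‖d (ρ i)‖ else 0) •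
        ((fun n ↦ ‖D n‖⁻¹ • D n) ∘ ρ) i = (a i * (‖d (ρ i)‖ / ‖D (ρ i)‖)) • (D ∘ ρ) i := fun i ↦ by
      simp only [Fin.is_lt, dif_pos, Function.comp_apply, smul_smul]
      rw [mul_assoc, div_eq_mul_inv]
    rw [Finset.sum_congr rfl fun i _ ↦ e1 i, Finset.sum_congr rfl fun i _ ↦ e2 i] at h1
    have h2 : ‖∑ i : Fin n, (a i * (‖d (ρ i)‖ / ‖D (ρ i)‖)) • (D ∘ ρ) i‖ ≤
        ‖∑ i : Fin n, (B / η * a i) • (D ∘ ρ) i‖ := by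
      refine norm_sum_le_of_disjoint_of_abs_le _
        (fun i j hij ↦ hDDabs _ _ (hρne (Fin.val_ne_of_ne hij))) fun i ↦ ?_
      rw [abs_mul, abs_mul, mul_comm, abs_of_nonneg (by positivity : 0 ≤ B / η),
        abs_of_nonneg (by positivity : 0 ≤ ‖d (ρ i)‖ / ‖D (ρ i)‖)]
      gcongr
      · exact hB _
      · exact hDη _
    have h3 : ‖∑ i : Fin n, (B / η * a i) • (D ∘ ρ) i‖ = B / η * ‖∑ i : Fin n, a i • (D ∘ ρ) i‖ := by
      simp only [← smul_smul]
      rw [← Finset.smul_sum, norm_smul, Real.norm_of_nonneg (by positivity)]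
    have h4 := norm_sum_disjoint_le_signAvg (fun i : Fin n ↦ (D ∘ ρ) i) (fun i ↦ S (d (ρ i)))
      (fun i ↦ hD _) (fun i j hij ↦ hDD _ _ (hρne (Fin.val_ne_of_ne hij))) a
    have h5 := huncρ.signAvg_le a
    have h6 : ∑ i : Fin n, a i • ((S ∘ d) ∘ ρ) i = S (∑ i : Fin n, a i • (d ∘ ρ) i) := by
      simp only [map_sum, map_smul, Function.comp_apply]
    rw [h6] at h5
    calc ‖∑ i : Fin n, a i • (d ∘ ρ) i‖
        ≤ C * ‖∑ i : Fin n, (a i * (‖d (ρ i)‖ / ‖D (ρ i)‖)) • (D ∘ ρ) i‖ := h1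
      _ ≤ C * (B / η * ‖∑ i : Fin n, a i • (D ∘ ρ) i‖) := by rw [← h3]; gcongr
      _ ≤ C * (B / η * (√2 * (K * ‖S (∑ i : Fin n, a i • (d ∘ ρ) i)‖))) := by
          gcongr
          exact h4.trans (mul_le_mul_of_nonneg_left h5 (Real.sqrt_nonneg 2))
      _ = _ := by ring

/-- A strictly singular operator on a disjointly homogeneous lattice maps bounded disjoint sequences
to almost order bounded ones. -/
theorem IsStrictlySingular.isAlmostOrderBounded_of_disjoint (hDH : IsDisjointlyHomogeneous E)
    {S : E →L[ℝ] E} (hS : IsStrictlySingular S) {u : E} (hu : IsQuasiInterior u) {d : ℕ → E}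
    (hd : ∀ j k, j ≠ k → |d j| ⊓ |d k| = 0) {B : ℝ} (hB : ∀ n, ‖d n‖ ≤ B)
    (hSd : IsCoordNull b (S ∘ d)) : IsAlmostOrderBounded u (S ∘ d) := by
  by_contra hnot
  obtain ⟨ε, hε, hfreq⟩ : ∃ ε : ℝ, 0 < ε ∧ ∀ M : ℝ, 0 ≤ M →
      ∃ᶠ n in atTop, ε < ‖(|S (d n)| - M • u)⁺‖ := by
    rw [IsAlmostOrderBounded] at hnot
    push Not at hnot
    obtain ⟨ε, hε, h⟩ := hnot
    exact ⟨ε, hε, fun M hM ↦ h M hM⟩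
  obtain ⟨φ, hφ, hφε⟩ := extraction_forall_of_frequently fun k : ℕ ↦ hfreq k k.cast_nonneg
  -- The truncation level grows with `k`, so the Chebyshev inequality makes these excesses un-null
  -- although their norms stay above `ε`.
  set y : ℕ → E := fun k ↦ (|S (d (φ k))| - (k : ℝ) • u)⁺ with hy
  have hy0 : ∀ k, 0 ≤ y k := fun k ↦ posPart_nonneg _
  have hyS : ∀ k, y k ≤ |S (d (φ k))| := fun k ↦
    sup_le (sub_le_self _ (smul_nonneg k.cast_nonneg hu.1)) (abs_nonneg _)
  have hB0 : 0 ≤ B := (norm_nonneg _).trans (hB 0)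
  have hSB : ∀ n, ‖S (d n)‖ ≤ ‖S‖ * B := fun n ↦
    (S.le_opNorm _).trans (mul_le_mul_of_nonneg_left (hB n) (norm_nonneg _))
  have hyB : ∀ k, ‖y k‖ ≤ ‖S‖ * B := fun k ↦ by
    refine le_trans ?_ (hSB (φ k))
    rw [← norm_abs_eq_norm (S _)]
    exact norm_le_norm_of_nonneg_of_le (hy0 k) (hyS k)
  have hyun : IsUnNull u y := by
    have h1 : ∀ k : ℕ, (k : ℝ) * ‖|y k| ⊓ u‖ ≤ ‖S‖ * B := fun k ↦ by
      rw [abs_of_nonneg (hy0 k), ← Real.norm_of_nonneg (k.cast_nonneg (α := ℝ)), ← norm_smul]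
      refine le_trans ?_ (hSB (φ k))
      rw [← norm_abs_eq_norm (S _)]
      exact norm_le_norm_of_nonneg_of_le (smul_nonneg k.cast_nonneg (le_inf (hy0 k) hu.1))
        (smul_posPart_sub_inf_le (abs_nonneg _) k.cast_nonneg)
    refine squeeze_zero' (Eventually.of_forall fun k ↦ norm_nonneg _) ?_
      (tendsto_const_div_atTop_nhds_zero_nat (‖S‖ * B))
    filter_upwards [eventually_gt_atTop 0] with k hk
    rw [le_div_iff₀ (by exact_mod_cast hk), mul_comm]
    exact h1 k
  obtain ⟨ψ, D, hψ, hD, hDD, hlim⟩ := hyun.exists_disjoint_subseq_of_nonneg hu hy0 hyB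
  obtain ⟨N, hN⟩ := eventually_atTop.1 (hlim.eventually_lt_const (half_pos hε))
  have hDε : ∀ k, ε / 2 ≤ ‖D (k + N)‖ := fun k ↦ by
    have h1 := hN (k + N) (Nat.le_add_left _ _)
    have h2 := hφε (ψ (k + N))
    have h3 := norm_sub_norm_le (y (ψ (k + N))) (D (k + N))
    have h4 : ε < ‖y (ψ (k + N))‖ := h2
    linarith
  have hDS : ∀ k, 0 ≤ D (k + N) ∧ D (k + N) ≤ |S (d (φ (ψ (k + N))))| := fun k ↦
    ⟨(hD _).1, (hD _).2.trans (hyS _)⟩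
  have hτ : StrictMono fun k ↦ φ (ψ (k + N)) := fun i j hij ↦
    hφ (hψ (Nat.add_lt_add_right hij N))
  obtain ⟨θ, hθ, K, hK, hunc⟩ := b.exists_unconditional_subseq (fun k ↦ S (d (φ (ψ (k + N)))))
    (hSd.comp hτ.tendsto_atTop) (half_pos hε) fun k ↦ by
      refine (hDε k).trans ?_
      rw [← norm_abs_eq_norm (S _)]
      exact norm_le_norm_of_nonneg_of_le (hDS k).1 (hDS k).2
  exact hS.false_of_disjoint_minorant hDH (d := fun k ↦ d (φ (ψ (θ k + N))))
    (D := fun k ↦ D (θ k + N)) (fun j k hjk ↦ hd _ _ ((hτ.comp hθ).injective.ne hjk))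
    (fun n ↦ hB _) (fun n ↦ hDS _)
    (fun j k hjk ↦ hDD _ _ fun h ↦ hjk (hθ.injective (Nat.add_right_cancel h)))
    (half_pos hε) (fun n ↦ hDε _) hK hunc

theorem IsStrictlySingular.exists_isAlmostOrderBounded_subseq (hDH : IsDisjointlyHomogeneous E)
    {S : E →L[ℝ] E} (hS : IsStrictlySingular S) {u : E} (hu : IsQuasiInterior u) {x : ℕ → E}
    (hx : IsUnNull u x) {B : ℝ} (hB : ∀ n, ‖x n‖ ≤ B) (hSx : IsCoordNull b (S ∘ x)) :
    ∃ φ : ℕ → ℕ, StrictMono φ ∧ IsAlmostOrderBounded u (S ∘ x ∘ φ) := by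
  obtain ⟨φ, d, hφ, hdB, hd, hlim⟩ := hx.exists_disjoint_subseq hu hB
  have hSlim : Tendsto (fun k ↦ S (x (φ k)) - S (d k)) atTop (𝓝 0) := by
    have := (S.continuous.tendsto 0).comp hlim
    simpa only [Function.comp_def, map_sub, map_zero] using this
  have hSd : IsCoordNull b (S ∘ d) := fun i ↦ by
    have h1 := ((b.coord i).continuous.tendsto 0).comp hSlim
    have h2 := (hSx i).comp hφ.tendsto_atTop
    simpa [Function.comp_def] using h2.sub h1
  have hdab := hS.isAlmostOrderBounded_of_disjoint b hDH hu hd hdB hSd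
  refine ⟨φ, hφ, fun ε hε ↦ ?_⟩
  obtain ⟨M, hM, h⟩ := hdab (ε / 2) (half_pos hε)
  refine ⟨M, hM, ?_⟩
  filter_upwards [h, (tendsto_zero_iff_norm_tendsto_zero.1 hSlim).eventually_lt_const
    (half_pos hε)] with n h1 h2
  have h3 := norm_posPart_sub_le_add (S (x (φ n))) (S (d n)) (M • u)
  simp only [Function.comp_apply] at h1 ⊢
  linarith

end StrictlySingular

/-! ### Extraction of coordinates, the quasi-interior point, and compactness of the square. -/

section Compactness

open Filter Topology

variable {E : Type*} [NormedAddCommGroup E] [NormedSpace ℝ E]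

theorem IsStrictlySingular.comp_left {S T : E →L[ℝ] E} (hT : IsStrictlySingular T) :
    IsStrictlySingular (S ∘L T) := fun V hV ⟨c, hc, h⟩ ↦ by
  refine hT V hV ⟨c / (‖S‖ + 1), by positivity, fun v hv ↦ ?_⟩
  rw [div_mul_eq_mul_div, div_le_iff₀ (by positivity)]
  have h1 := (h v hv).trans (S.le_opNorm (T v))
  linarith [norm_nonneg (T v)]

omit [NormedSpace ℝ E] in
theorem cauchySeq_of_forall_subseq {x : ℕ → E}
    (h : ∀ p q : ℕ → ℕ, Tendsto p atTop atTop → Tendsto q atTop atTop →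
      ∃ θ : ℕ → ℕ, StrictMono θ ∧ Tendsto (fun k ↦ x (p (θ k)) - x (q (θ k))) atTop (𝓝 0)) :
    CauchySeq x := by
  by_contra hnot
  rw [Metric.cauchySeq_iff] at hnot
  push Not at hnot
  obtain ⟨ε, hε, hN⟩ := hnot
  choose p hp q hq hpq using hN
  obtain ⟨θ, -, hlim⟩ := h p q (tendsto_atTop_mono hp tendsto_id) (tendsto_atTop_mono hq tendsto_id)
  obtain ⟨k, hk⟩ := ((tendsto_zero_iff_norm_tendsto_zero.1 hlim).eventually_lt_const hε).exists
  have := hpq (θ k)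
  rw [dist_eq_norm] at this
  linarith

/-- All coordinates of the sequence `x` converge. -/
def IsCoordConvergent {ι : Type*} (b : UnconditionalSchauderBasis ι ℝ E) (x : ℕ → E) : Prop :=
  ∀ i, ∃ l : ℝ, Tendsto (fun n ↦ b.coord i (x n)) atTop (𝓝 l)

variable {ι : Type*} (b : UnconditionalSchauderBasis ι ℝ E)

variable {b} in
theorem IsCoordConvergent.sub_comp {x : ℕ → E} (hx : IsCoordConvergent b x) {p q : ℕ → ℕ}
    (hp : Tendsto p atTop atTop) (hq : Tendsto q atTop atTop) :
    ∀ i, Tendsto (fun k ↦ b.coord i (x (p k) - x (q k))) atTop (𝓝 0) := fun i ↦ by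
  obtain ⟨l, hl⟩ := hx i
  simpa [Function.comp_def] using (hl.comp hp).sub (hl.comp hq)

/-- The coordinates lie in a countable product of compact intervals, which is sequentially compact.
-/
theorem exists_coordConvergent_subseq [Countable ι] {J : Type*} [Countable J] (g : J → ℕ → E)
    (hg : ∀ j, ∃ B, ∀ n, ‖g j n‖ ≤ B) :
    ∃ φ : ℕ → ℕ, StrictMono φ ∧ ∀ j, IsCoordConvergent b (g j ∘ φ) := by
  choose B hB using hg
  let F : ℕ → J × ι → ℝ := fun n r ↦ b.coord r.2 (g r.1 n)
  have hK : IsCompact (Set.univ.pi fun r : J × ι ↦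
      Set.Icc (-(‖b.coord r.2‖ * B r.1)) (‖b.coord r.2‖ * B r.1)) :=
    isCompact_univ_pi fun r ↦ isCompact_Icc
  have hF : ∀ n, F n ∈ Set.univ.pi fun r : J × ι ↦
      Set.Icc (-(‖b.coord r.2‖ * B r.1)) (‖b.coord r.2‖ * B r.1) := fun n r _ ↦
    abs_le.1 (((b.coord r.2).le_opNorm _).trans
      (mul_le_mul_of_nonneg_left (hB _ _) (norm_nonneg _)))
  obtain ⟨l, -, φ, hφ, hl⟩ := hK.tendsto_subseq hF
  exact ⟨φ, hφ, fun j i ↦ ⟨l (j, i), tendsto_pi_nhds.1 hl (j, i)⟩⟩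

theorem eq_zero_of_coord_eq_zero {x : E} (h : ∀ i, b.coord i x = 0) : x = 0 := by
  have h1 := b.expansion x
  simp only [h, zero_smul] at h1
  exact h1.unique hasSum_zero

variable [Lattice E] [IsOrderedAddMonoid E] [IsOrderedModule ℝ E] [HasSolidNorm E]

/-- Take `u = ∑ δᵢ |bᵢ|` with weights small enough for convergence. Every finite basis projection of
`x` is dominated by a multiple of `u`, and these projections approximate `x`. -/
theorem exists_isQuasiInterior [CompleteSpace E] [Countable ι]
    (b : UnconditionalSchauderBasis ι ℝ E) : ∃ u : E, IsQuasiInterior u := by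
  obtain ⟨ε', hε', c, hc, -⟩ := NNReal.exists_pos_sum_of_countable (one_ne_zero) ι
  set δ : ι → ℝ := fun i ↦ ε' i / (1 + ‖b i‖) with hδ
  have hδ0 : ∀ i, 0 < δ i := fun i ↦
    div_pos (by exact_mod_cast hε' i) (by positivity)
  have hterm : ∀ i, ‖δ i • |b i|‖ ≤ ε' i := fun i ↦ by
    rw [norm_smul, norm_abs_eq_norm, Real.norm_of_nonneg (hδ0 i).le, hδ, div_mul_eq_mul_div,
      div_le_iff₀ (by positivity)]
    exact mul_le_mul_of_nonneg_left (by linarith) (ε' i).2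
  have hsum : Summable fun i ↦ δ i • |b i| :=
    Summable.of_norm_bounded (NNReal.summable_coe.2 hc.summable) hterm
  have hpos : ∀ i, 0 ≤ δ i • |b i| := fun i ↦ smul_nonneg (hδ0 i).le (abs_nonneg _)
  set u := ∑' i, δ i • |b i| with hu
  have hu0 : 0 ≤ u := tsum_nonneg hpos
  refine ⟨u, hu0, fun x ε hε ↦ ?_⟩
  have h1 : Tendsto (fun A ↦ ‖x - b.proj A x‖) atTop (𝓝 0) := by
    have h3 := b.tendsto_proj x
    rw [SummationFilter.unconditional_filter] at h3
    simpa using ((tendsto_const_nhds (x := x)).sub h3).norm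
  obtain ⟨A, hA⟩ := (h1.eventually_lt_const hε).exists
  refine ⟨∑ i ∈ A, |b.coord i x| / δ i,
    Finset.sum_nonneg fun i _ ↦ div_nonneg (abs_nonneg _) (hδ0 i).le, ?_⟩
  refine (norm_posPart_sub_le_add x (b.proj A x) _).trans ?_
  have h2 : |b.proj A x| ≤ (∑ i ∈ A, |b.coord i x| / δ i) • u := by
    rw [GeneralSchauderBasis.proj_apply, Finset.sum_smul]
    refine (lattice_abs_sum_le _ _).trans (Finset.sum_le_sum fun i _ ↦ ?_)
    rw [lattice_abs_smul]
    calc |b.coord i x| • |b i| = (|b.coord i x| / δ i) • (δ i • |b i|) := by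
          rw [smul_smul, div_mul_cancel₀ _ (hδ0 i).ne']
      _ ≤ _ := smul_le_smul_of_nonneg_left (hsum.le_tsum i fun j _ ↦ hpos j)
          (div_nonneg (abs_nonneg _) (hδ0 i).le)
  rw [posPart_eq_zero.2 (sub_nonpos.2 h2), norm_zero, zero_add]
  exact hA.le

omit [IsOrderedModule ℝ E] in
theorem IsAlmostOrderBounded.sub {u : E} {x y : ℕ → E} (hx : IsAlmostOrderBounded u x)
    (hy : IsAlmostOrderBounded u y) : IsAlmostOrderBounded u (fun n ↦ x n - y n) := fun ε hε ↦ by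
  obtain ⟨M₁, hM₁, h₁⟩ := hx (ε / 2) (half_pos hε)
  obtain ⟨M₂, hM₂, h₂⟩ := hy (ε / 2) (half_pos hε)
  refine ⟨M₁ + M₂, add_nonneg hM₁ hM₂, ?_⟩
  filter_upwards [h₁, h₂] with n h3 h4
  have h5 : (|x n - y n| - (M₁ + M₂) • u)⁺ ≤ (|x n| - M₁ • u)⁺ + (|y n| - M₂ • u)⁺ := by
    refine le_trans (posPart_mono ?_) (posPart_add_le _ _)
    have : |x n - y n| ≤ |x n| + |y n| := by
      simpa [sub_eq_add_neg] using abs_add_le (x n) (-y n)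
    calc |x n - y n| - (M₁ + M₂) • u ≤ (|x n| + |y n|) - (M₁ + M₂) • u := sub_le_sub_right this _
      _ = _ := by rw [add_smul]; abel
  have := (norm_le_norm_of_nonneg_of_le (posPart_nonneg _) h5).trans (norm_add_le _ _)
  linarith

omit [NormedSpace ℝ E] [IsOrderedModule ℝ E] [HasSolidNorm E] in
theorem abs_latticeTrunc_sub_le {w : E} (hw : 0 ≤ w) (x y : E) :
    |latticeTrunc w x - latticeTrunc w y| ≤ w + w := by
  calc |latticeTrunc w x - latticeTrunc w y| ≤ |latticeTrunc w x| + |latticeTrunc w y| := by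
        simpa [sub_eq_add_neg] using abs_add_le (latticeTrunc w x) (-latticeTrunc w y)
    _ ≤ w + w := add_le_add (abs_latticeTrunc_le hw x) (abs_latticeTrunc_le hw y)

omit [NormedSpace ℝ E] [IsOrderedModule ℝ E] in
theorem norm_latticeTrunc_le {w : E} (hw : 0 ≤ w) (x : E) : ‖latticeTrunc w x‖ ≤ ‖w‖ :=
  norm_le_norm_of_abs_le (abs_latticeTrunc_le hw x)

variable [CompleteSpace E]

/-- The first `T` makes the sequence un-null, the second makes it almost order bounded along
subsequences; `T ∘ T` being strictly singular, the result is also un-null, hence null. -/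
theorem IsStrictlySingular.tendsto_sq_of_abs_le (hDH : IsDisjointlyHomogeneous E)
    (hcot : HasFiniteCotype E) {T : E →L[ℝ] E} (hT : IsStrictlySingular T) {u : E}
    (hu : IsQuasiInterior u) {w : E} (hw : 0 ≤ w) {e : ℕ → E} (hew : ∀ n, |e n| ≤ w)
    (he : IsCoordNull b e) (hTe : IsCoordNull b (T ∘ e)) (hTTe : IsCoordNull b ((T ∘L T) ∘ e)) :
    Tendsto (fun n ↦ T (T (e n))) atTop (𝓝 0) := by
  have hTT : IsStrictlySingular (T ∘L T) := hT.comp_left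
  refine tendsto_of_subseq_tendsto fun ns hns ↦ ?_
  have h1 : IsUnNull u (T ∘ e) := hT.isUnNull_of_abs_le b hcot hu.1 hw hew he hTe
  have h2 : IsUnNull u ((T ∘L T) ∘ e) := hTT.isUnNull_of_abs_le b hcot hu.1 hw hew he hTTe
  have hTeB : ∀ n, ‖(T ∘ e ∘ ns) n‖ ≤ ‖T‖ * ‖w‖ := fun n ↦
    (T.le_opNorm _).trans (mul_le_mul_of_nonneg_left (norm_le_norm_of_abs_le (hew _))
      (norm_nonneg _))
  obtain ⟨φ, hφ, hab⟩ := hT.exists_isAlmostOrderBounded_subseq b hDH hu (x := T ∘ e ∘ ns)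
    (h1.comp hns) hTeB (hTTe.comp hns)
  exact ⟨φ, (h2.comp (hns.comp hφ.tendsto_atTop)).tendsto_zero hu.1 hab⟩

theorem IsStrictlySingular.exists_subseq_tendsto_sq_of_isUnNull [Countable ι]
    (hDH : IsDisjointlyHomogeneous E) (hcot : HasFiniteCotype E) {T : E →L[ℝ] E}
    (hT : IsStrictlySingular T) {u : E} (hu : IsQuasiInterior u) {x : ℕ → E} (hx : IsUnNull u x)
    {B : ℝ} (hB : ∀ n, ‖x n‖ ≤ B) (hTx : IsCoordNull b (T ∘ x))
    (hTTx : IsCoordNull b ((T ∘L T) ∘ x)) :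
    ∃ φ : ℕ → ℕ, StrictMono φ ∧ Tendsto (fun n ↦ T (T (x (φ n)))) atTop (𝓝 0) := by
  have hTT : IsStrictlySingular (T ∘L T) := hT.comp_left
  obtain ⟨φ₁, hφ₁, hab₁⟩ := hT.exists_isAlmostOrderBounded_subseq b hDH hu hx hB hTx
  obtain ⟨φ₂, hφ₂, hab₂⟩ := hTT.exists_isAlmostOrderBounded_subseq b hDH hu (x := x ∘ φ₁)
    (hx.comp hφ₁.tendsto_atTop) (fun n ↦ hB _) (hTTx.comp hφ₁.tendsto_atTop)
  set y : ℕ → E := T ∘ x ∘ φ₁ ∘ φ₂ with hy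
  have hyab : IsAlmostOrderBounded u y := hab₁.comp hφ₂.tendsto_atTop
  have hTyab : IsAlmostOrderBounded u (T ∘ y) := hab₂
  have hMu : ∀ M : ℕ, 0 ≤ (M : ℝ) • u := fun M ↦ smul_nonneg M.cast_nonneg hu.1
  -- Truncation is not linear and need not preserve coordinatewise convergence, so the convergence
  -- is extracted at all integer levels at once.
  obtain ⟨φ₃, hφ₃, hconv⟩ := exists_coordConvergent_subseq b
    (fun (j : ℕ × Bool) n ↦ bif j.2 then T (latticeTrunc ((j.1 : ℝ) • u) (y n))
      else latticeTrunc ((j.1 : ℝ) • u) (y n)) (by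
    rintro ⟨M, _ | _⟩
    · exact ⟨‖(M : ℝ) • u‖, fun n ↦ norm_latticeTrunc_le (hMu M) _⟩
    · exact ⟨‖T‖ * ‖(M : ℝ) • u‖, fun n ↦ (T.le_opNorm _).trans
        (mul_le_mul_of_nonneg_left (norm_latticeTrunc_le (hMu M) _) (norm_nonneg _))⟩)
  set z : ℕ → E := y ∘ φ₃ with hz
  have hzab : IsAlmostOrderBounded u z := hyab.comp hφ₃.tendsto_atTop
  have hTzab : IsAlmostOrderBounded u (T ∘ z) := hTyab.comp hφ₃.tendsto_atTop
  have hcauchy : CauchySeq (T ∘ z) := by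
    refine cauchySeq_of_forall_subseq fun p q hp hq ↦ ⟨id, strictMono_id, ?_⟩
    refine IsUnNull.tendsto_zero hu.1 ?_ ((hTzab.comp hp).sub (hTzab.comp hq))
    rw [IsUnNull, Metric.tendsto_nhds]
    intro ε hε
    -- The two truncation errors cost `ε / 4` each after applying `T`; the order bounded difference
    -- costs less than `ε / 2`.
    obtain ⟨M₀, hM₀, hev⟩ := hzab (ε / (4 * (‖T‖ + 1))) (by positivity)
    obtain ⟨M, hM⟩ := exists_nat_ge M₀
    set t : E → E := latticeTrunc ((M : ℝ) • u) with ht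
    have htail : ∀ᶠ n in atTop, ‖T (z n - t (z n))‖ ≤ ε / 4 := by
      filter_upwards [hev] with n hn
      have h1 : ‖z n - t (z n)‖ ≤ ε / (4 * (‖T‖ + 1)) := by
        refine (norm_le_norm_of_abs_le (abs_sub_latticeTrunc_le _ _)).trans (le_trans ?_ hn)
        exact norm_le_norm_of_nonneg_of_le (posPart_nonneg _) (posPart_mono
          (sub_le_sub_left (smul_le_smul_of_nonneg_right hM hu.1) _))
      have h2 := (T.le_opNorm (z n - t (z n))).trans
        (mul_le_mul_of_nonneg_left h1 (norm_nonneg T))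
      refine h2.trans ?_
      rw [mul_div_assoc', div_le_div_iff₀ (by positivity) (by norm_num)]
      nlinarith
    have hun : IsUnNull u (T ∘ fun k ↦ t (z (p k)) - t (z (q k))) :=
      hT.isUnNull_of_abs_le b hcot hu.1 (add_nonneg (hMu M) (hMu M))
        (fun n ↦ abs_latticeTrunc_sub_le (hMu M) _ _) ((hconv (M, false)).sub_comp hp hq) (by
          have := (hconv (M, true)).sub_comp hp hq
          simpa only [IsCoordNull, Function.comp_apply, map_sub, cond_true] using! this)
    filter_upwards [hp.eventually htail, hq.eventually htail,
      hun.eventually_lt_const (half_pos hε)] with k h1 h2 h3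
    rw [dist_zero_right, norm_norm]
    have h4 : (T ∘ z) (p (id k)) - (T ∘ z) (q (id k)) = T (t (z (p k)) - t (z (q k))) +
        (T (z (p k) - t (z (p k))) + -T (z (q k) - t (z (q k)))) := by
      simp only [map_sub, Function.comp_apply, id]; abel
    rw [h4]
    have h5 := norm_abs_inf_le_add hu.1 (T (t (z (p k)) - t (z (q k))))
      (T (z (p k) - t (z (p k))) + -T (z (q k) - t (z (q k))))
    have h6 := (norm_abs_inf_le hu.1 (T (z (p k) - t (z (p k))) + -T (z (q k) - t (z (q k))))).trans
      (norm_add_le _ _)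
    rw [norm_neg] at h6
    simp only [Function.comp_apply] at h3
    linarith
  obtain ⟨l, hl⟩ := cauchySeq_tendsto_of_complete hcauchy
  have hτ := hφ₁.comp (hφ₂.comp hφ₃)
  -- The Cauchy argument alone does not identify the limit; the null coordinates of `T (T x)` do.
  have hl0 : l = 0 := eq_zero_of_coord_eq_zero b fun i ↦
    tendsto_nhds_unique (((b.coord i).continuous.tendsto l).comp hl)
      ((hTTx i).comp hτ.tendsto_atTop)
  exact ⟨_, hτ, hl0 ▸ hl⟩

theorem IsStrictlySingular.exists_subseq_cauchySeq_sq [Countable ι]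
    (b : UnconditionalSchauderBasis ι ℝ E)
    (hDH : IsDisjointlyHomogeneous E) (hcot : HasFiniteCotype E) {T : E →L[ℝ] E}
    (hT : IsStrictlySingular T) (f : ℕ → E) {B : ℝ} (hB : ∀ n, ‖f n‖ ≤ B) :
    ∃ φ : ℕ → ℕ, StrictMono φ ∧ CauchySeq fun n ↦ T (T (f (φ n))) := by
  obtain ⟨u, hu⟩ := exists_isQuasiInterior b
  have hMu : ∀ M : ℕ, 0 ≤ (M : ℝ) • u := fun M ↦ smul_nonneg M.cast_nonneg hu.1
  obtain ⟨φ, hφ, hconv⟩ := exists_coordConvergent_subseq b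
    (fun (j : Option ℕ × ℕ) n ↦
      (T ^ j.2) (j.1.elim (f n) fun M ↦ latticeTrunc ((M : ℝ) • u) (f n))) (by
    rintro ⟨_ | M, m⟩
    · exact ⟨‖T ^ m‖ * B, fun n ↦ ((T ^ m).le_opNorm _).trans
        (mul_le_mul_of_nonneg_left (hB n) (norm_nonneg _))⟩
    · exact ⟨‖T ^ m‖ * ‖(M : ℝ) • u‖, fun n ↦ ((T ^ m).le_opNorm _).trans
        (mul_le_mul_of_nonneg_left (norm_latticeTrunc_le (hMu M) _) (norm_nonneg _))⟩)
  refine ⟨φ, hφ, cauchySeq_of_forall_subseq fun p q hp hq ↦ ?_⟩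
  set g : ℕ → E := f ∘ φ with hg
  set x : ℕ → E := fun k ↦ g (p k) - g (q k) with hx
  set e : ℕ → ℕ → E := fun M k ↦
    latticeTrunc ((M : ℝ) • u) (g (p k)) - latticeTrunc ((M : ℝ) • u) (g (q k)) with he
  have hxnull : ∀ m, IsCoordNull b (fun k ↦ (T ^ m) (x k)) := fun m ↦ by
    have := (hconv (none, m)).sub_comp hp hq
    simpa only [IsCoordNull, hx, map_sub] using! this
  have henull : ∀ M m, IsCoordNull b (fun k ↦ (T ^ m) (e M k)) := fun M m ↦ by
    have := (hconv (some M, m)).sub_comp hp hq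
    simpa only [IsCoordNull, he, map_sub] using! this
  have hTsq : ∀ v, (T ^ 2) v = T (T v) := fun v ↦ by rw [pow_two]; rfl
  have hT1 : ∀ v, (T ^ 1) v = T v := fun v ↦ by rw [pow_one]
  have hT0 : ∀ v, (T ^ 0) v = v := fun v ↦ by rw [pow_zero]; rfl
  have hTTe : ∀ M, Tendsto (fun k ↦ T (T (e M k))) atTop (𝓝 0) := fun M ↦
    hT.tendsto_sq_of_abs_le b hDH hcot hu (add_nonneg (hMu M) (hMu M))
      (fun k ↦ abs_latticeTrunc_sub_le (hMu M) _ _)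
      (by simpa only [hT0] using henull M 0) (by simpa only [hT1] using! henull M 1)
      (by simpa only [hTsq] using! henull M 2)
  -- All limits needed at level `M` are bundled in one first-countable space, so that a single
  -- diagonal `κ` serves them all while the truncation level tends to infinity.
  let h : ℕ → ℕ → E × (ι → ℝ) × (ι → ℝ) := fun M k ↦
    (T (T (e M k)), (fun i ↦ b.coord i (T (e M k))), fun i ↦ b.coord i (T (T (e M k))))
  have hh : ∀ M, Tendsto (h M) atTop (𝓝 0) := fun M ↦ by
    refine (hTTe M).prodMk_nhds (Tendsto.prodMk_nhds ?_ ?_)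
    · exact tendsto_pi_nhds.2 (by simpa only [hT1] using! henull M 1)
    · exact tendsto_pi_nhds.2 (by simpa only [hTsq] using! henull M 2)
  obtain ⟨U, hU⟩ := (𝓝 (0 : E × (ι → ℝ) × (ι → ℝ))).exists_antitone_basis
  obtain ⟨κ, hκ, hκU⟩ := extraction_forall_of_eventually fun M ↦
    (hh M).eventually (hU.toHasBasis.mem_of_mem (i := M) trivial)
  have hdiag : Tendsto (fun M ↦ h M (κ M)) atTop (𝓝 0) := hU.tendsto hκU
  have hd1 : Tendsto (fun M ↦ T (T (e M (κ M)))) atTop (𝓝 0) :=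
    (continuous_fst.tendsto _).comp hdiag
  have hd2 : ∀ i, Tendsto (fun M ↦ b.coord i (T (e M (κ M)))) atTop (𝓝 0) := fun i ↦
    (((continuous_apply i).comp (continuous_fst.comp continuous_snd)).tendsto _).comp hdiag
  have hd3 : ∀ i, Tendsto (fun M ↦ b.coord i (T (T (e M (κ M))))) atTop (𝓝 0) := fun i ↦
    (((continuous_apply i).comp (continuous_snd.comp continuous_snd)).tendsto _).comp hdiag
  -- The remainder above level `M`, along the diagonal: bounded, and un-null by the Chebyshev
  -- inequality.
  set r : ℕ → E := fun M ↦ x (κ M) - e M (κ M) with hr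
  have hrdec : ∀ M, r M = (g (p (κ M)) - latticeTrunc ((M : ℝ) • u) (g (p (κ M)))) +
      -(g (q (κ M)) - latticeTrunc ((M : ℝ) • u) (g (q (κ M)))) := fun M ↦ by
    simp only [hr, hx, he]; abel
  have hB0 : 0 ≤ B := (norm_nonneg _).trans (hB 0)
  have hgB : ∀ n, ‖g n‖ ≤ B := fun n ↦ hB _
  have htailB : ∀ (M : ℕ) (v : E), ‖v - latticeTrunc ((M : ℝ) • u) v‖ ≤ ‖v‖ := fun M v ↦ by
    refine norm_le_norm_of_abs_le_abs ((abs_sub_latticeTrunc_le _ _).trans ?_)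
    exact sup_le (sub_le_self _ (hMu M)) (abs_nonneg _)
  have hrB : ∀ M, ‖r M‖ ≤ B + B := fun M ↦ by
    rw [hrdec]
    refine (norm_add_le _ _).trans ?_
    rw [norm_neg]
    exact add_le_add ((htailB M _).trans (hgB _)) ((htailB M _).trans (hgB _))
  have htailu : ∀ (M : ℕ) (v : E),
      (M : ℝ) * ‖|v - latticeTrunc ((M : ℝ) • u) v| ⊓ u‖ ≤ ‖v‖ := fun M v ↦ by
    rw [← Real.norm_of_nonneg (M.cast_nonneg (α := ℝ)), ← norm_smul, ← norm_abs_eq_norm v]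
    refine norm_le_norm_of_nonneg_of_le
      (smul_nonneg M.cast_nonneg (le_inf (abs_nonneg _) hu.1)) ?_
    rw [Real.norm_of_nonneg (M.cast_nonneg (α := ℝ))]
    exact (smul_le_smul_of_nonneg_left (inf_le_inf_right _ (abs_sub_latticeTrunc_le _ _))
      M.cast_nonneg).trans (smul_posPart_sub_inf_le (abs_nonneg _) M.cast_nonneg)
  have hrun : IsUnNull u r := by
    refine squeeze_zero' (Eventually.of_forall fun k ↦ norm_nonneg _) ?_
      (tendsto_const_div_atTop_nhds_zero_nat (B + B))
    filter_upwards [eventually_gt_atTop 0] with M hM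
    rw [le_div_iff₀ (by exact_mod_cast hM), mul_comm, hrdec]
    refine (mul_le_mul_of_nonneg_left (norm_abs_inf_le_add hu.1 _ _) M.cast_nonneg).trans ?_
    rw [abs_neg, mul_add]
    exact add_le_add ((htailu M _).trans (hgB _)) ((htailu M _).trans (hgB _))
  have hTr : IsCoordNull b (T ∘ r) := fun i ↦ by
    have h1 := (hxnull 1 i).comp hκ.tendsto_atTop
    simpa [hT1, hr, Function.comp_def] using h1.sub (hd2 i)
  have hTTr : IsCoordNull b ((T ∘L T) ∘ r) := fun i ↦ by
    have h1 := (hxnull 2 i).comp hκ.tendsto_atTop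
    simpa [hTsq, hr, Function.comp_def] using h1.sub (hd3 i)
  obtain ⟨θ, hθ, hlim⟩ := hT.exists_subseq_tendsto_sq_of_isUnNull b hDH hcot hu hrun hrB hTr hTTr
  refine ⟨κ ∘ θ, hκ.comp hθ, ?_⟩
  have h1 := hlim.add (hd1.comp hθ.tendsto_atTop)
  simpa [hr, hx, hg, Function.comp_def] using h1

end Compactness

theorem mainTheorem3 {E : Type*} [NormedAddCommGroup E] [NormedSpace ℝ E] [CompleteSpace E]
    [Lattice E] [IsOrderedAddMonoid E] [IsOrderedModule ℝ E] [HasSolidNorm E]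
    (hDH : IsDisjointlyHomogeneous E) (hcotype : HasFiniteCotype E)
    {ι : Type*} [Countable ι] (b : UnconditionalSchauderBasis ι ℝ E)
    (T : E →L[ℝ] E) (hT : IsStrictlySingular T) :
    IsCompactOperator (T ^ 2 : E →L[ℝ] E) := by
  have hTsq : ∀ v, (T ^ 2) v = T (T v) := fun v ↦ by rw [pow_two]; rfl
  refine (isCompactOperator_iff_isCompact_closure_image_closedBall
    ((T ^ 2 : E →L[ℝ] E) : E →ₗ[ℝ] E) zero_lt_one).2 (IsSeqCompact.isCompact fun y hy ↦ ?_)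
  -- Points of the closure need not be images; approximation within `1 / (n + 1)` suffices to
  -- transfer a convergent subsequence.
  have h1 : ∀ n : ℕ, ∃ v : E, ‖v‖ ≤ 1 ∧ dist (y n) (T (T v)) < 1 / ((n : ℝ) + 1) := fun n ↦ by
    obtain ⟨_, ⟨v, hv, rfl⟩, hd⟩ := Metric.mem_closure_iff.1 (hy n) (1 / ((n : ℝ) + 1))
      (by positivity)
    exact ⟨v, mem_closedBall_zero_iff.1 hv, by rw [← hTsq]; exact hd⟩
  choose f hf hfy using h1
  obtain ⟨φ, hφ, hc⟩ := hT.exists_subseq_cauchySeq_sq b hDH hcotype f hf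
  obtain ⟨l, hl⟩ := cauchySeq_tendsto_of_complete hc
  have hyl : Filter.Tendsto (y ∘ φ) Filter.atTop (nhds l) := by
    have h2 : Filter.Tendsto (fun n ↦ dist (T (T (f (φ n)))) (y (φ n))) Filter.atTop (nhds 0) := by
      refine squeeze_zero (fun n ↦ dist_nonneg) (fun n ↦ ?_)
        (tendsto_one_div_add_atTop_nhds_zero_nat.comp hφ.tendsto_atTop)
      rw [dist_comm]
      exact (hfy (φ n)).le
    exact hl.congr_dist h2
  exact ⟨l, isClosed_closure.mem_of_tendsto hyl (Filter.Eventually.of_forall fun n ↦ hy _),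
    φ, hφ, hyl⟩
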